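/- **Theorem 3.** Let $X=(X_1,\dots,X_n)\in\mathbb R^{d\times n}$, $Y\in\mathbb R^n$, let $\mathcal D\subset\mathbb R^d$ be a nonempty closed convex set, and put $p(\xi)=\sum_{i=1}^n\delta_{\mathcal D}(\xi_i)$ for $\xi=(\xi_1;\dots;\xi_n)\in\mathbb R^{dn}$, where $\delta_C$ is the indicator function of $C$ ($0$ on $C$, $+\infty$ elsewhere). Let $A=e_n\otimes I_n-I_n\otimes e_n\in\mathbb R^{n^2\times n}$ and $B=\mathrm{Diag}(B_1,\dots,B_n)\in\mathbb R^{n^2\times dn}$ with $B_i=e_nX_i^T-X^T$. Let $\sigma>0$, let $H_1\in\mathbb R^{n\times n}$, $H_2\in\mathbb R^{dn\times dn}$ be symmetric positive definite, and let $(\tilde\theta,\tilde\xi,\tilde u,\tilde v)\in\mathbb R^n\times\mathbb R^{dn}\times\mathbb R^{n^2}\times\mathbb R^{dn}$. With $\mathrm E_q(x)=\min_y\{q(y)+\frac12\|y-x\|^2\}$ (attained at $\mathrm{Prox}_q(x)$), $\delta_+$ the indicator function of $\mathbb R^{n^2}_+$, and $\|x\|_H^2=\langle x,Hx\rangle$,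 consider the subproblem of minimizing over $\mathbb R^n\times\mathbb R^{dn}$ $$\Phi(\theta,\xi)=\tfrac12\|\theta-Y\|^2+\sigma \mathrm E_p\big(\xi-\tfrac{\tilde v}{\sigma}\big)+\sigma \mathrm E_{\delta_+}\big(A\theta+B\xi-\tfrac{\tilde u}{\sigma}\big)-\tfrac1{2\sigma}\|\tilde u\|^2-\tfrac1{2\sigma}\|\tilde v\|^2+\tfrac1{2\sigma}\|\theta-\tilde\theta\|_{H_1}^2+\tfrac1{2\sigma}\|\xi-\tilde\xi\|_{H_2}^2 .$$ Let $\hat\partial^2\Phi(\theta,\xi)$ be the set of all matrices $$\sigma\begin{pmatrix}A^T\\B^T\end{pmatrix}(I-P)\begin{pmatrix}A&B\end{pmatrix}+\begin{pmatrix}I_n+\frac1\sigma H_1&0\\0&\sigma(I-Q)+\frac1\sigma H_2\end{pmatrix},$$ where $Q$ lies in the Clarke generalized Jacobian $\partial\mathrm{Prox}_p(\xi-\tilde v/\sigma)$ and $P=\mathrm{Diag}(q)$ with, for $\eta=A\theta+B\xi-\tilde u/\sigma$, $q_i=0$ if $\eta_i<0$, $q_i\in[0,1]$ if $\eta_i=0$,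 $q_i=1$ if $\eta_i>0$. Semismooth Newton method, with parameters $\bar\gamma,\delta\in(0,1)$, $\tau\in(0,1]$, $\mu\in(0,\frac12)$ and any starting point $(\theta^0,\xi^0)$. For $j=0,1,2,\dots$: (1) select $\mathcal H_j\in\hat\partial^2\Phi(\theta^j,\xi^j)$ and compute an approximate solution $(\Delta\theta^j,\Delta\xi^j)$ of $\mathcal H_j(\Delta\theta,\Delta\xi)=-\nabla\Phi(\theta^j,\xi^j)$, either exactly (direct method) or as an iterate of the preconditioned conjugate gradient (PCG) method started at $0$ with an arbitrary symmetric positive definite preconditioner, such that $R_j=\mathcal H_j(\Delta\theta^j,\Delta\xi^j)+\nabla\Phi(\theta^j,\xi^j)$ satisfies $\|R_j\|\le\min(\bar\gamma,\|\nabla\Phi(\theta^j,\xi^j)\|^{1+\tau})$; (2) let $m_j$ be the smallest integer $m\ge0$ with $\Phi(\theta^j+\delta^m\Delta\theta^j,\xi^j+\delta^m\Delta\xi^j)\le\Phi(\theta^j,\xi^j)+\mu\delta^m\langle\nabla\Phi(\theta^j,\xi^j),(\Delta\theta^j,\Delta\xi^j)\rangle$; (3) set $(\theta^{j+1},\xi^{j+1})=(\theta^j,\xi^j)+\delta^{m_j}(\Delta\theta^j,\Delta\xi^j)$.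 Suppose that $\mathrm{Prox}_p$ is strongly semismooth with respect to $\partial\mathrm{Prox}_p$, that is, it is locally Lipschitz and, at every $x$, directionally differentiable with $\mathrm{Prox}_p(x+h)-\mathrm{Prox}_p(x)-Vh=O(\|h\|^2)$ as $h\to0$, uniformly in $V\in\partial\mathrm{Prox}_p(x+h)$. Let $\{(\theta^j,\xi^j)\}$ be an infinite sequence generated by the method. Then $\Phi$ has a unique minimizer $(\bar\theta,\bar\xi)$, the sequence $\{(\theta^j,\xi^j)\}$ converges to $(\bar\theta,\bar\xi)$, and $$\|(\theta^{j+1},\xi^{j+1})-(\bar\theta,\bar\xi)\|=O\big(\|(\theta^j,\xi^j)-(\bar\theta,\bar\xi)\|^{1+\tau}\big)\quad(j\to\infty).$$ In particular $\|(\theta^{j+1},\xi^{j+1})-(\bar\theta,\bar\xi)\|=o(\|(\theta^j,\xi^j)-(\bar\theta,\bar\xi)\|)$, and the convergence is quadratic if $\tau=1$. -/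

import Mathlib

open Filter Topology Asymptotics

namespace ConvexRegression

noncomputable section

/-! ### Moreau envelope and proximal mapping -/

section Prox

variable {E : Type*} [NormedAddCommGroup E]

/-- The indicator function `δ_C`: `0` on `C` and `+∞` off `C`. -/
def indicatorFn (C : Set E) (x : E) : EReal :=
  open Classical in if x ∈ C then 0 else ⊤

/-- The objective `q y + ½ ‖y - x‖²` of the problem that defines the Moreau envelope. -/
def proxObjective (q : E → EReal) (x y : E) : EReal :=
  q y + ((1 / 2 * ‖y - x‖ ^ 2 : ℝ) : EReal)

/-- The Moreau envelope `E_q(x) = min_y { q y + ½ ‖y - x‖² }`, which is real-valued when `q` is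
closed proper convex. -/
def moreauEnvelope (q : E → EReal) (x : E) : ℝ :=
  (⨅ y, proxObjective q x y).toReal

/-- `Prox_q(x)`: the minimizer of `q y + ½ ‖y - x‖²` over `y` (it exists and is unique when `q` is
closed proper convex on a Euclidean space). -/
def prox (q : E → EReal) (x : E) : E :=
  Classical.epsilon fun y => ∀ w, proxObjective q x y ≤ proxObjective q x w

end Prox

/-! ### Clarke generalized Jacobian and strong semismoothness -/

section Semismooth

variable {ι : Type*} [Fintype ι] [DecidableEq ι]

/-- The Clarke generalized Jacobian of `F` at `x`: the convex hull of all limits of Jacobian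
matrices of `F` along sequences of differentiability points that converge to `x`. -/
def clarkeJacobian (F : EuclideanSpace ℝ ι → EuclideanSpace ℝ ι) (x : EuclideanSpace ℝ ι) :
    Set (Matrix ι ι ℝ) :=
  convexHull ℝ {V | ∃ (u : ℕ → EuclideanSpace ℝ ι) (J : ℕ → Matrix ι ι ℝ),
    Tendsto u atTop (𝓝 x) ∧
    (∀ k, HasFDerivAt F (Matrix.toEuclideanCLM (n := ι) (𝕜 := ℝ) (J k)) (u k)) ∧
    Tendsto J atTop (𝓝 V)}

/-- `F` is strongly semismooth (everywhere) with respect to the multifunction `K`: it is locally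
Lipschitz, directionally differentiable at every `x`, and
`F (x + h) - F x - V h = O(‖h‖²)` as `h → 0`, uniformly in `V ∈ K (x + h)`. -/
def StronglySemismooth (F : EuclideanSpace ℝ ι → EuclideanSpace ℝ ι)
    (K : EuclideanSpace ℝ ι → Set (Matrix ι ι ℝ)) : Prop :=
  LocallyLipschitz F ∧
  ∀ x : EuclideanSpace ℝ ι,
    (∀ h : EuclideanSpace ℝ ι, ∃ L : EuclideanSpace ℝ ι,
      Tendsto (fun t : ℝ => t⁻¹ • (F (x + t • h) - F x)) (𝓝[>] 0) (𝓝 L)) ∧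
    (∃ C : ℝ, ∃ ε > 0, ∀ h : EuclideanSpace ℝ ι, ‖h‖ < ε → ∀ V ∈ K (x + h),
      ‖F (x + h) - F x - Matrix.toEuclideanLin V h‖ ≤ C * ‖h‖ ^ 2)

end Semismooth

/-! ### The preconditioned conjugate gradient method -/

section PCG

variable {ι : Type*} [Fintype ι] [DecidableEq ι]

/-- Current iterate, residual and search direction of the PCG method. -/
structure PCGState (ι : Type*) where
  /-- the iterate -/
  x : EuclideanSpace ℝ ι
  /-- the residual `b - H x` -/
  r : EuclideanSpace ℝ ι
  /-- the conjugate search direction -/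
  s : EuclideanSpace ℝ ι

/-- One step of PCG for a system with matrix `H` and preconditioner `M`. If the residual is
already zero, then the iterate does not change any more (`0 / a = 0`). -/
def pcgStep (H M : Matrix ι ι ℝ) (c : PCGState ι) : PCGState ι :=
  let Hs := Matrix.toEuclideanLin H c.s
  let ρ := inner ℝ c.r (Matrix.toEuclideanLin M⁻¹ c.r)
  let a := ρ / inner ℝ c.s Hs
  let r' := c.r - a • Hs
  let y' := Matrix.toEuclideanLin M⁻¹ r'
  { x := c.x + a • c.s
    r := r'
    s := y' + (inner ℝ r' y' / ρ) • c.s }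

/-- The iterates of PCG for `H x = b` with preconditioner `M`, started at `x = 0`. -/
def pcg (H M : Matrix ι ι ℝ) (b : EuclideanSpace ℝ ι) : ℕ → PCGState ι
  | 0 => { x := 0, r := b, s := Matrix.toEuclideanLin M⁻¹ b }
  | k + 1 => pcgStep H M (pcg H M b k)

/-- `x` is produced for the system `H x = b` by a direct method (exact solution) or by finitely
many steps of PCG, started at zero, with some symmetric positive definite preconditioner. -/
def DirectOrPCG (H : Matrix ι ι ℝ) (b x : EuclideanSpace ℝ ι) : Prop :=
  Matrix.toEuclideanLin H x = b ∨
    ∃ M : Matrix ι ι ℝ, M.PosDef ∧ ∃ k : ℕ, x = (pcg H M b k).x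

end PCG

/-! ### The proxALM subproblem -/

/-- The vector `(θ, ξ) ∈ ℝⁿ × ℝ^{dn}` is indexed by `Fin n ⊕ Fin n × Fin d`; the entry `(i, k)` of
`ξ` is the `k`-th coordinate of the block `ξ_i ∈ ℝ^d`. -/
abbrev Var (n d : ℕ) : Type := EuclideanSpace ℝ (Fin n ⊕ Fin n × Fin d)

variable {n d : ℕ}

/-- The component `θ` of `(θ, ξ)`. -/
def thetaPart (z : Var n d) : EuclideanSpace ℝ (Fin n) :=
  WithLp.toLp 2 fun i => z (Sum.inl i)

/-- The component `ξ` of `(θ, ξ)`. -/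
def xiPart (z : Var n d) : EuclideanSpace ℝ (Fin n × Fin d) :=
  WithLp.toLp 2 fun q => z (Sum.inr q)

/-- The block `ξ_i ∈ ℝ^d` of `ξ ∈ ℝ^{dn}`. -/
def block (ξ : EuclideanSpace ℝ (Fin n × Fin d)) (i : Fin n) : EuclideanSpace ℝ (Fin d) :=
  WithLp.toLp 2 fun k => ξ (i, k)

/-- `A = e_n ⊗ I_n - I_n ⊗ e_n`, so `(A θ)_{(i,j)} = θ_j - θ_i`. -/
def matA (n : ℕ) : Matrix (Fin n × Fin n) (Fin n) ℝ :=
  Matrix.of fun r k => (1 : Matrix (Fin n) (Fin n) ℝ) r.2 k - (1 : Matrix (Fin n) (Fin n) ℝ) r.1 k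

/-- `B = Diag(B_1, …, B_n)` with `B_i = e_n X_iᵀ - Xᵀ`, so `(B ξ)_{(i,j)} = ⟨ξ_i, X_i - X_j⟩`. The
data points `X_i` are the columns of `X`. -/
def matB (X : Matrix (Fin d) (Fin n) ℝ) : Matrix (Fin n × Fin n) (Fin n × Fin d) ℝ :=
  Matrix.of fun r q => if r.1 = q.1 then X q.2 r.1 - X q.2 r.2 else 0

/-- `p(ξ) = ∑ i, δ_𝒟(ξ_i)`. -/
def penalty (n : ℕ) (D : Set (EuclideanSpace ℝ (Fin d))) (ξ : EuclideanSpace ℝ (Fin n × Fin d)) :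
    EReal :=
  ∑ i, indicatorFn D (block ξ i)

/-- The nonnegative orthant. -/
def orthant (ι : Type*) : Set (EuclideanSpace ℝ ι) := {η | ∀ i, 0 ≤ η i}

/-- `‖x‖_H² = ⟨x, H x⟩`. -/
def normSqH {ι : Type*} [Fintype ι] [DecidableEq ι] (H : Matrix ι ι ℝ) (x : EuclideanSpace ℝ ι) :
    ℝ :=
  inner ℝ x (Matrix.toEuclideanLin H x)

/-- The data of a proxALM subproblem: data points `X, Y`, the set `𝒟`, the proximal matrices
`H₁, H₂`, the penalty parameter `σ` and the current `(θ̃, ξ̃, ũ, ṽ)`. -/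
structure Subproblem (n d : ℕ) where
  /-- the data points `X_i ∈ ℝ^d`, as columns -/
  X : Matrix (Fin d) (Fin n) ℝ
  /-- the observations -/
  Y : EuclideanSpace ℝ (Fin n)
  /-- the set in which the subgradients are constrained to lie -/
  D : Set (EuclideanSpace ℝ (Fin d))
  /-- the proximal matrix for `θ` -/
  H₁ : Matrix (Fin n) (Fin n) ℝ
  /-- the proximal matrix for `ξ` -/
  H₂ : Matrix (Fin n × Fin d) (Fin n × Fin d) ℝ
  /-- the penalty parameter -/
  σ : ℝ
  /-- `θ̃` -/
  θt : EuclideanSpace ℝ (Fin n)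
  /-- `ξ̃` -/
  ξt : EuclideanSpace ℝ (Fin n × Fin d)
  /-- `ũ` -/
  ut : EuclideanSpace ℝ (Fin n × Fin n)
  /-- `ṽ` -/
  vt : EuclideanSpace ℝ (Fin n × Fin d)

namespace Subproblem

variable (S : Subproblem n d)

/-- `p` -/
def p : EuclideanSpace ℝ (Fin n × Fin d) → EReal := penalty n S.D

/-- `A θ + B ξ - u / σ` -/
def slack (θ : EuclideanSpace ℝ (Fin n)) (ξ : EuclideanSpace ℝ (Fin n × Fin d))
    (u : EuclideanSpace ℝ (Fin n × Fin n)) : EuclideanSpace ℝ (Fin n × Fin n) :=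
  Matrix.toEuclideanLin (matA n) θ + Matrix.toEuclideanLin (matB S.X) ξ - S.σ⁻¹ • u

/-- The augmented Lagrangian `ℒ_σ(θ, ξ; u, v)`. -/
def augLagrangian (θ : EuclideanSpace ℝ (Fin n)) (ξ : EuclideanSpace ℝ (Fin n × Fin d))
    (u : EuclideanSpace ℝ (Fin n × Fin n)) (v : EuclideanSpace ℝ (Fin n × Fin d)) : ℝ :=
  1 / 2 * ‖θ - S.Y‖ ^ 2
    + S.σ * moreauEnvelope S.p (ξ - S.σ⁻¹ • v)
    + S.σ * moreauEnvelope (indicatorFn (orthant (Fin n × Fin n))) (S.slack θ ξ u)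
    - 1 / (2 * S.σ) * ‖u‖ ^ 2 - 1 / (2 * S.σ) * ‖v‖ ^ 2

/-- The objective of the subproblem,
`Φ(θ, ξ) = ℒ_σ(θ, ξ; ũ, ṽ) + ‖θ - θ̃‖²_{H₁} / (2σ) + ‖ξ - ξ̃‖²_{H₂} / (2σ)`. -/
def Phi (z : Var n d) : ℝ :=
  S.augLagrangian (thetaPart z) (xiPart z) S.ut S.vt
    + 1 / (2 * S.σ) * normSqH S.H₁ (thetaPart z - S.θt)
    + 1 / (2 * S.σ) * normSqH S.H₂ (xiPart z - S.ξt)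

end Subproblem

/-- The generalized Jacobian `∂Π₊(η)` of the projection onto the nonnegative orthant: all `Diag(q)`
with `q_i = 0` if `η_i < 0`, `q_i ∈ [0,1]` if `η_i = 0`, and `q_i = 1` if `η_i > 0`. -/
def jacobianOrthant {ι : Type*} [DecidableEq ι] (η : EuclideanSpace ℝ ι) : Set (Matrix ι ι ℝ) :=
  {P | ∃ q : ι → ℝ, P = Matrix.diagonal q ∧
    ∀ i, (η i < 0 → q i = 0) ∧ (η i = 0 → q i ∈ Set.Icc 0 1) ∧ (0 < η i → q i = 1)}

namespace Subproblem

variable (S : Subproblem n d)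

/-- The generalized Hessian `∂̂²Φ(θ, ξ)`: all matrices
`σ (A B)ᵀ (I - P) (A B) + Diag(I + H₁ / σ, σ (I - Q) + H₂ / σ)` with
`P ∈ ∂Π₊(A θ + B ξ - ũ / σ)` and `Q ∈ ∂Prox_p(ξ - ṽ / σ)`. -/
def genHessian (z : Var n d) :
    Set (Matrix (Fin n ⊕ Fin n × Fin d) (Fin n ⊕ Fin n × Fin d) ℝ) :=
  {H | ∃ P ∈ jacobianOrthant (S.slack (thetaPart z) (xiPart z) S.ut),
    ∃ Q ∈ clarkeJacobian (prox S.p) (xiPart z - S.σ⁻¹ • S.vt),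
      H = S.σ • ((Matrix.fromCols (matA n) (matB S.X)).transpose * (1 - P)
            * Matrix.fromCols (matA n) (matB S.X))
          + Matrix.fromBlocks (1 + S.σ⁻¹ • S.H₁) 0 0 (S.σ • (1 - Q) + S.σ⁻¹ • S.H₂)}

/-- One iteration, from `z = (θ^j, ξ^j)` to `z' = (θ^{j+1}, ξ^{j+1})`, of the semismooth Newton
method with parameters `γ` (tolerance), `τ`, `δ` (backtracking factor) and `μ` (Armijo). -/
def SSNStep (γ τ δ μ : ℝ) (z z' : Var n d) : Prop :=
  ∃ H ∈ S.genHessian z, ∃ Δ : Var n d,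
    DirectOrPCG H (-gradient S.Phi z) Δ ∧
    ‖Matrix.toEuclideanLin H Δ + gradient S.Phi z‖ ≤ min γ (‖gradient S.Phi z‖ ^ (1 + τ)) ∧
    ∃ m : ℕ,
      IsLeast {m : ℕ | S.Phi (z + δ ^ m • Δ) ≤
        S.Phi z + μ * δ ^ m * inner ℝ (gradient S.Phi z) Δ} m ∧
      z' = z + δ ^ m • Δ

end Subproblem

end

end ConvexRegression

open ConvexRegression

namespace ConvexRegression

open scoped InnerProductSpace

/-! ### Orthogonality relations of the preconditioned conjugate gradient method -/

section PCG

variable {ι : Type*} [Fintype ι] [DecidableEq ι]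

/-! `Φ` is strongly convex: the least-squares term controls `θ`, the `H₂` term controls `ξ`, and the
Moreau envelopes are half squared distances to closed convex sets, hence convex with nonexpansive
gradient. So the Bregman distances of `Φ` lie between multiples of `‖y - x‖ ^ 2`, and every
generalized Hessian lies between the same constants `c` and `L` (`exists_bounds`). Everything else
is an abstract Newton argument (`newton_convergence`).

Global convergence. A PCG iterate started at `0` is orthogonal to its own residual
(`DirectOrPCG.inner_residual`), so `⟪∇Φ, Δ⟫ = -⟪H Δ, Δ⟫ ≤ -c ‖Δ‖ ^ 2` however early PCG is stopped.
The residual is at most a fixed fraction `κ < 1` of the gradient (`min_rpow_le`), so `Δ` is not too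
short, and Armijo step lengths stay away from `0`. Each step thus decreases `Φ` by a multiple of the
squared distance to the minimizer; as `Φ` is bounded below, that distance tends to `0`.

Local rate. Semismoothness and the residual rule make the full step reduce an error `e` to `O(‖e‖ ^
(1 + τ))`. The full step must also pass the Armijo test. As `Φ` need not be twice differentiable, a
Taylor expansion is replaced by the trapezoidal bound `Φ (z + h) - Φ z - ⟪∇Φ z, h⟫ ≥ ½ ⟪∇Φ (z + h) -
∇Φ z, h⟫ - O(‖h‖ ^ 3)`, obtained by integrating the semismooth estimate along rays
(`IsProjection.exists_trapezoid_le`). Since `μ < 1/2`, this suffices near the minimizer. -/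

theorem inner_toEuclideanLin_comm {M : Matrix ι ι ℝ} (hM : M.IsHermitian)
    (v w : EuclideanSpace ℝ ι) :
    ⟪Matrix.toEuclideanLin M v, w⟫_ℝ = ⟪v, Matrix.toEuclideanLin M w⟫_ℝ :=
  (Matrix.isSymmetric_toEuclideanLin_iff.mpr hM) v w

theorem inner_toEuclideanLin_self_pos {M : Matrix ι ι ℝ} (hM : M.PosDef)
    {v : EuclideanSpace ℝ ι} (hv : v ≠ 0) : 0 < ⟪v, Matrix.toEuclideanLin M v⟫_ℝ := by
  have h := hM.dotProduct_mulVec_pos (x := WithLp.ofLp v) (by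
    intro h; apply hv; ext i; exact congrFun h i)
  simpa [EuclideanSpace.inner_eq_star_dotProduct, Matrix.toLpLin_apply,
    dotProduct_comm] using h

/-- The relations that hold between the `k`-th PCG state and all earlier ones. -/
structure PCGInvariant (H M : Matrix ι ι ℝ) (b : EuclideanSpace ℝ ι) (k : ℕ) : Prop where
  residual : (pcg H M b k).r = b - Matrix.toEuclideanLin H (pcg H M b k).x
  direction_eq_zero : (pcg H M b k).r = 0 → (pcg H M b k).s = 0
  inner_direction : ⟪(pcg H M b k).r, (pcg H M b k).s⟫_ℝ =
    ⟪(pcg H M b k).r, Matrix.toEuclideanLin M⁻¹ (pcg H M b k).r⟫_ℝ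
  orthogonal : ∀ i < k, ⟪(pcg H M b k).r, (pcg H M b i).s⟫_ℝ = 0
  conjugate : ∀ i < k,
    ⟪(pcg H M b k).s, Matrix.toEuclideanLin H (pcg H M b i).s⟫_ℝ = 0

variable {H M : Matrix ι ι ℝ} {b : EuclideanSpace ℝ ι}

theorem pcg_succ_x (k : ℕ) : (pcg H M b (k + 1)).x = (pcg H M b k).x +
    (⟪(pcg H M b k).r, Matrix.toEuclideanLin M⁻¹ (pcg H M b k).r⟫_ℝ /
      ⟪(pcg H M b k).s, Matrix.toEuclideanLin H (pcg H M b k).s⟫_ℝ) • (pcg H M b k).s := rfl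

theorem pcg_succ_r (k : ℕ) : (pcg H M b (k + 1)).r = (pcg H M b k).r -
    (⟪(pcg H M b k).r, Matrix.toEuclideanLin M⁻¹ (pcg H M b k).r⟫_ℝ /
      ⟪(pcg H M b k).s, Matrix.toEuclideanLin H (pcg H M b k).s⟫_ℝ) •
        Matrix.toEuclideanLin H (pcg H M b k).s := rfl

theorem pcg_succ_s (k : ℕ) : (pcg H M b (k + 1)).s =
    Matrix.toEuclideanLin M⁻¹ (pcg H M b (k + 1)).r +
    (⟪(pcg H M b (k + 1)).r, Matrix.toEuclideanLin M⁻¹ (pcg H M b (k + 1)).r⟫_ℝ /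
      ⟪(pcg H M b k).r, Matrix.toEuclideanLin M⁻¹ (pcg H M b k).r⟫_ℝ) • (pcg H M b k).s := rfl

/-- A preconditioned residual is orthogonal to everything that the search directions up to that
index are orthogonal to. -/
theorem inner_preconditioned_residual_eq_zero {w : EuclideanSpace ℝ ι} {k : ℕ}
    (hw : ∀ i ≤ k, ⟪w, (pcg H M b i).s⟫_ℝ = 0) {i : ℕ} (hi : i ≤ k) :
    ⟪w, Matrix.toEuclideanLin M⁻¹ (pcg H M b i).r⟫_ℝ = 0 := by
  cases i with
  | zero => exact hw 0 (Nat.zero_le _)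
  | succ i =>
    have h1 := hw (i + 1) hi
    rw [pcg_succ_s, inner_add_right, inner_smul_right, hw i (by omega), mul_zero, add_zero] at h1
    exact h1

/-- A vanishing residual forces a vanishing direction, after which the residual stays zero. Hence,
while PCG has not converged, no earlier coefficient has a zero denominator. -/
theorem pcg_residual_ne_zero_of_le {k : ℕ}
    (hk : (pcg H M b k).r ≠ 0) (hinv : ∀ i ≤ k, PCGInvariant H M b i) {i : ℕ} (hi : i ≤ k) :
    (pcg H M b i).r ≠ 0 := by
  intro h0
  apply hk
  induction k, hi using Nat.le_induction with
  | base => exact h0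
  | succ k hik ih =>
    have hr : (pcg H M b k).r = 0 := by
      by_contra hne
      exact hne (ih hne fun j hj => hinv j (by omega))
    rw [pcg_succ_r, hr, (hinv k (by omega)).direction_eq_zero hr]
    simp

/-- The classical conjugate gradient induction. All relations have to be carried together:
orthogonality of the new residual uses conjugacy of the old directions, and conjugacy of the new
direction uses orthogonality of the new residual. -/
theorem pcgInvariant (hH : H.IsHermitian)
    (hHpos : ∀ v, v ≠ 0 → 0 < ⟪v, Matrix.toEuclideanLin H v⟫_ℝ) (hM : M.PosDef) (k : ℕ) :
    PCGInvariant H M b k := by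
  induction k using Nat.strong_induction_on with
  | _ k ih =>
  cases k with
  | zero =>
    refine ⟨by simp [pcg], fun h => ?_, rfl, by simp, by simp⟩
    have hb : b = 0 := h
    simp [pcg, hb]
  | succ k =>
    have hk := ih k (by omega)
    by_cases hr : (pcg H M b k).r = 0
    · have hs := hk.direction_eq_zero hr
      have hx' : (pcg H M b (k + 1)).x = (pcg H M b k).x := by rw [pcg_succ_x, hs]; simp
      have hr' : (pcg H M b (k + 1)).r = 0 := by rw [pcg_succ_r, hs, hr]; simp
      have hs' : (pcg H M b (k + 1)).s = 0 := by rw [pcg_succ_s, hs, hr']; simp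
      refine ⟨?_, fun _ => hs', by simp [hr'], by simp [hr'], by simp [hs']⟩
      rw [hr', hx', ← hk.residual, hr]
    have hMi := hM.inv
    have hne : ∀ i ≤ k, (pcg H M b i).r ≠ 0 := fun i hi =>
      pcg_residual_ne_zero_of_le hr (fun j hj => ih j (by omega)) hi
    have hρ : ∀ i ≤ k, 0 < ⟪(pcg H M b i).r, Matrix.toEuclideanLin M⁻¹ (pcg H M b i).r⟫_ℝ :=
      fun i hi => inner_toEuclideanLin_self_pos hMi (hne i hi)
    have hsH : ∀ i ≤ k, 0 < ⟪(pcg H M b i).s, Matrix.toEuclideanLin H (pcg H M b i).s⟫_ℝ := by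
      intro i hi
      -- The direction is nonzero because its inner product with the residual is `⟪r, M⁻¹ r⟫ > 0`.
      apply hHpos
      intro h0
      have h1 := (ih i (by omega)).inner_direction
      rw [h0, inner_zero_right] at h1
      exact (hρ i hi).ne h1
    have horth : ∀ i ≤ k, ⟪(pcg H M b (k + 1)).r, (pcg H M b i).s⟫_ℝ = 0 := by
      intro i hi
      rw [pcg_succ_r, inner_sub_left, inner_smul_left, inner_toEuclideanLin_comm hH]
      rcases hi.lt_or_eq with hlt | rfl
      · rw [hk.orthogonal i hlt, hk.conjugate i hlt]; simp
      · rw [hk.inner_direction]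
        have := (hsH i le_rfl).ne'
        simp only [conj_trivial]
        field_simp
        ring
    have hy : ∀ i ≤ k,
        ⟪(pcg H M b (k + 1)).r, Matrix.toEuclideanLin M⁻¹ (pcg H M b i).r⟫_ℝ = 0 :=
      fun i hi => inner_preconditioned_residual_eq_zero horth hi
    refine ⟨?_, ?_, ?_, fun i hi => horth i (by omega), ?_⟩
    · rw [pcg_succ_r, pcg_succ_x, hk.residual, map_add, map_smul]
      abel
    · intro h0
      rw [pcg_succ_s, h0]; simp
    · rw [pcg_succ_s, inner_add_right, inner_smul_right, horth k le_rfl]; simp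
    · intro i hi
      have hi' : i ≤ k := by omega
      -- The residual recursion solved for `H sᵢ`: conjugacy to `sᵢ` becomes a statement about `⟪M⁻¹
      -- r, rᵢ - rᵢ₊₁⟫`.
      have hHs : Matrix.toEuclideanLin H (pcg H M b i).s =
          (⟪(pcg H M b i).r, Matrix.toEuclideanLin M⁻¹ (pcg H M b i).r⟫_ℝ /
            ⟪(pcg H M b i).s, Matrix.toEuclideanLin H (pcg H M b i).s⟫_ℝ)⁻¹ •
            ((pcg H M b i).r - (pcg H M b (i + 1)).r) := by
        rw [pcg_succ_r, sub_sub_cancel, smul_smul, inv_mul_cancel₀, one_smul]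
        exact (div_pos (hρ i hi') (hsH i hi')).ne'
      have h1 : ⟪Matrix.toEuclideanLin M⁻¹ (pcg H M b (k + 1)).r, (pcg H M b i).r⟫_ℝ = 0 := by
        rw [inner_toEuclideanLin_comm hMi.isHermitian, hy i hi']
      rw [pcg_succ_s, inner_add_left, inner_smul_left]
      rcases hi'.lt_or_eq with hlt | rfl
      · rw [hk.conjugate i hlt, hHs, inner_smul_right, inner_sub_right, h1,
          inner_toEuclideanLin_comm hMi.isHermitian, hy (i + 1) (by omega)]
        simp
      -- For the latest direction `⟪M⁻¹ r, rᵢ₊₁⟫` survives; the coefficient of the old direction is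
      -- chosen to cancel it.
      · conv_lhs => arg 1; rw [hHs]
        rw [inner_smul_right, inner_sub_right, h1, inner_toEuclideanLin_comm hMi.isHermitian]
        have h2 := (hsH i le_rfl).ne'
        have h3 := (hρ i le_rfl).ne'
        simp only [conj_trivial]
        field_simp
        ring

/-- The iterate is a combination of the earlier search directions, to all of which the residual is
orthogonal. -/
theorem pcg_residual_inner_iterate (hH : H.IsHermitian)
    (hHpos : ∀ v, v ≠ 0 → 0 < ⟪v, Matrix.toEuclideanLin H v⟫_ℝ) (hM : M.PosDef) (k : ℕ) :
    ⟪(pcg H M b k).r, (pcg H M b k).x⟫_ℝ = 0 := by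
  have h : ∀ j ≤ k, ⟪(pcg H M b k).r, (pcg H M b j).x⟫_ℝ = 0 := by
    intro j
    induction j with
    | zero => intro _; simp [pcg]
    | succ j ih =>
      intro hj
      rw [pcg_succ_x, inner_add_right, inner_smul_right, ih (by omega),
        (pcgInvariant hH hHpos hM k).orthogonal j (by omega)]
      simp
  exact h k le_rfl

/-- The residual of a direct or PCG solution is orthogonal to the solution. -/
theorem DirectOrPCG.inner_residual (hH : H.IsHermitian)
    (hHpos : ∀ v, v ≠ 0 → 0 < ⟪v, Matrix.toEuclideanLin H v⟫_ℝ) {x : EuclideanSpace ℝ ι}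
    (hx : DirectOrPCG H b x) : ⟪Matrix.toEuclideanLin H x - b, x⟫_ℝ = 0 := by
  rcases hx with hx | ⟨M, hM, k, rfl⟩
  · rw [hx, sub_self, inner_zero_left]
  · have h := pcg_residual_inner_iterate (b := b) hH hHpos hM k
    rw [(pcgInvariant hH hHpos hM k).residual] at h
    rw [← neg_sub, inner_neg_left, h, neg_zero]

end PCG

/-! ### Globalized Newton methods for strongly convex functions -/

section Newton

variable {E : Type*} [NormedAddCommGroup E] [InnerProductSpace ℝ E]

/-- The Bregman distances `Φ y - Φ x - ⟪F x, y - x⟫` lie between `c / 2 * ‖y - x‖ ^ 2` and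
`L / 2 * ‖y - x‖ ^ 2`. -/
def BregmanBounds (c L : ℝ) (Φ : E → ℝ) (F : E → E) : Prop :=
  ∀ x y, c / 2 * ‖y - x‖ ^ 2 ≤ Φ y - Φ x - ⟪F x, y - x⟫_ℝ ∧
    Φ y - Φ x - ⟪F x, y - x⟫_ℝ ≤ L / 2 * ‖y - x‖ ^ 2

namespace BregmanBounds

variable {c L : ℝ} {Φ : E → ℝ} {F : E → E}

theorem hasGradientAt [CompleteSpace E] (h : BregmanBounds c L Φ F) (hc : 0 ≤ c) (x : E) :
    HasGradientAt Φ (F x) x := by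
  rw [hasGradientAt_iff_isLittleO]
  have h1 : (fun y => Φ y - Φ x - ⟪F x, y - x⟫_ℝ) =O[𝓝 x] fun y => ‖y - x‖ ^ 2 := by
    refine IsBigO.of_bound (L / 2) (Eventually.of_forall fun y => ?_)
    have h0 : 0 ≤ Φ y - Φ x - ⟪F x, y - x⟫_ℝ := le_trans (by positivity) (h x y).1
    rw [Real.norm_of_nonneg h0, Real.norm_of_nonneg (by positivity)]
    exact (h x y).2
  refine h1.trans_isLittleO ?_
  have h2 : (fun y => ‖y - x‖ ^ 2) =o[𝓝 x] fun y => ‖y - x‖ := by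
    have h3 : (fun r : ℝ => r ^ 2) =o[𝓝 0] fun r => r := by
      simpa using isLittleO_pow_id (𝕜 := ℝ) (n := 2) (by norm_num)
    have h4 : Tendsto (fun y => ‖y - x‖) (𝓝 x) (𝓝 0) := by
      have : Continuous fun y => ‖y - x‖ := by fun_prop
      simpa using this.tendsto x
    exact h3.comp_tendsto h4
  exact h2.of_norm_right

theorem continuous [CompleteSpace E] (h : BregmanBounds c L Φ F) (hc : 0 ≤ c) : Continuous Φ :=
  continuous_iff_continuousAt.mpr fun x => (h.hasGradientAt hc x).continuousAt

/-- Sum of the lower Bregman bounds from `x` to `zbar` and from `zbar` to `x`. -/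
theorem le_inner (h : BregmanBounds c L Φ F) {zbar : E} (hbar : F zbar = 0) (x : E) :
    c * ‖x - zbar‖ ^ 2 ≤ ⟪F x, x - zbar⟫_ℝ := by
  have h1 := (h x zbar).1
  have h2 := (h zbar x).1
  rw [hbar, inner_zero_left] at h2
  rw [← neg_sub x zbar, norm_neg, inner_neg_right] at h1
  linarith

theorem norm_sub_le (h : BregmanBounds c L Φ F) {zbar : E} (hbar : F zbar = 0) (x : E) :
    c * ‖x - zbar‖ ≤ ‖F x‖ := by
  rcases (norm_nonneg (x - zbar)).eq_or_lt with h0 | h0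
  · rw [← h0]; simp
  · have h1 := (h.le_inner hbar x).trans (real_inner_le_norm _ _)
    exact le_of_mul_le_mul_right (by nlinarith) h0

theorem exists_zero [FiniteDimensional ℝ E] (h : BregmanBounds c L Φ F) (hc : 0 < c)
    (hL : 0 < L) : ∃ zbar, F zbar = 0 := by
  have : CompleteSpace E := FiniteDimensional.complete ℝ E
  have : ProperSpace E := FiniteDimensional.proper ℝ E
  -- On the sublevel set of `Φ 0` the lower bound gives `c / 2 * ‖x‖ ^ 2 ≤ ‖F 0‖ * ‖x‖`, whence the
  -- radius.
  obtain ⟨zbar, hmin⟩ := (h.continuous hc.le).exists_forall_le_of_isBounded 0 (by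
    refine (Metric.isBounded_closedBall (x := 0) (r := 2 * ‖F 0‖ / c)).subset ?_
    intro x hx
    have h1 := (h 0 x).1
    have h2 : Φ x ≤ Φ 0 := hx
    rw [sub_zero] at h1
    have h3 : -⟪F 0, x⟫_ℝ ≤ ‖F 0‖ * ‖x‖ :=
      (neg_le_abs _).trans (abs_real_inner_le_norm _ _)
    rw [mem_closedBall_zero_iff, le_div_iff₀ hc]
    rcases (norm_nonneg x).eq_or_lt with h0 | h0
    · rw [← h0]; simp
    · exact le_of_mul_le_mul_right (by nlinarith) h0)
  refine ⟨zbar, ?_⟩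
  -- A gradient step of length `1 / L` would lower `Φ` by at least `‖F zbar‖ ^ 2 / (2 * L)`, which
  -- minimality forbids unless `F zbar = 0`.
  have h1 := (h zbar (zbar - L⁻¹ • F zbar)).2
  have h2 := hmin (zbar - L⁻¹ • F zbar)
  rw [sub_sub_cancel_left, inner_neg_right, norm_neg, inner_smul_right, norm_smul,
    real_inner_self_eq_norm_sq, Real.norm_of_nonneg (inv_nonneg.mpr hL.le)] at h1
  have h3 : L / 2 * (L⁻¹ * ‖F zbar‖) ^ 2 = L⁻¹ * ‖F zbar‖ ^ 2 / 2 := by field_simp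
  rw [h3] at h1
  have h4 : L⁻¹ * ‖F zbar‖ ^ 2 ≤ 0 := by linarith
  have h5 : ‖F zbar‖ ^ 2 ≤ 0 := by
    by_contra hcon
    exact absurd h4 (not_le.mpr (mul_pos (inv_pos.mpr hL) (not_le.mp hcon)))
  exact norm_eq_zero.mp (pow_eq_zero_iff two_ne_zero |>.mp (le_antisymm h5 (by positivity)))

end BregmanBounds

/-- The residual tolerance of the inexact Newton method is a fixed fraction of the gradient. -/
theorem min_rpow_le {γ τ a : ℝ} (hγ : 0 < γ) (hτ : 0 < τ) (ha : 0 ≤ a) :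
    min γ (a ^ (1 + τ)) ≤ γ ^ (τ / (1 + τ)) * a := by
  have h1 : (0 : ℝ) < 1 + τ := by linarith
  have hm : 0 ≤ min γ (a ^ (1 + τ)) := le_min hγ.le (Real.rpow_nonneg ha _)
  have hsum : τ / (1 + τ) + 1 / (1 + τ) = 1 := by field_simp; ring
  -- Interpolation: the minimum is split into powers with exponents summing to one, and each factor
  -- is bounded by a different argument of the minimum.
  calc min γ (a ^ (1 + τ))
      = min γ (a ^ (1 + τ)) ^ (τ / (1 + τ)) * min γ (a ^ (1 + τ)) ^ (1 / (1 + τ)) := by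
        rw [← Real.rpow_add' hm (by rw [hsum]; norm_num), hsum, Real.rpow_one]
    _ ≤ γ ^ (τ / (1 + τ)) * (a ^ (1 + τ)) ^ (1 / (1 + τ)) := by
        gcongr
        · exact min_le_left _ _
        · exact min_le_right _ _
    _ = γ ^ (τ / (1 + τ)) * a := by
        rw [← Real.rpow_mul ha, mul_one_div_cancel h1.ne', Real.rpow_one]

/-- One step of a Newton method with generalized Hessian `T`, direction `Δ` and Armijo backtracking
exponent `m`; the residual of the Newton equation is orthogonal to the direction. -/
structure IsNewtonStep (Φ : E → ℝ) (F : E → E) (γ τ δ μ : ℝ) (T : E →ₗ[ℝ] E) (x Δ : E) (m : ℕ) :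
    Prop where
  orthogonal : ⟪T Δ + F x, Δ⟫_ℝ = 0
  residual : ‖T Δ + F x‖ ≤ min γ (‖F x‖ ^ (1 + τ))
  armijo : IsLeast {m : ℕ | Φ (x + δ ^ m • Δ) ≤ Φ x + μ * δ ^ m * ⟪F x, Δ⟫_ℝ} m

namespace IsNewtonStep

variable {c L : ℝ} {Φ : E → ℝ} {F : E → E} {γ τ δ μ : ℝ} {T : E →ₗ[ℝ] E} {x Δ : E} {m : ℕ}

theorem inner_le (h : IsNewtonStep Φ F γ τ δ μ T x Δ m)
    (hT : ∀ v, c * ‖v‖ ^ 2 ≤ ⟪T v, v⟫_ℝ) : ⟪F x, Δ⟫_ℝ ≤ -(c * ‖Δ‖ ^ 2) := by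
  have h1 := h.orthogonal
  rw [inner_add_left] at h1
  linarith [hT Δ]

theorem norm_le (h : IsNewtonStep Φ F γ τ δ μ T x Δ m) (hγ : 0 < γ) (hτ : 0 < τ)
    (hT : ∀ v, ‖T v‖ ≤ L * ‖v‖) : (1 - γ ^ (τ / (1 + τ))) * ‖F x‖ ≤ L * ‖Δ‖ := by
  have h1 := h.residual.trans (min_rpow_le hγ hτ (norm_nonneg (F x)))
  have h2 : ‖F x‖ ≤ ‖T Δ + F x‖ + ‖T Δ‖ := by
    calc ‖F x‖ = ‖(T Δ + F x) - T Δ‖ := by rw [add_sub_cancel_left]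
      _ ≤ _ := norm_sub_le _ _
  linarith [hT Δ]

/-- The upper Bregman bound shows that every `t` in `(0, 2 * (1 - μ) * c / L]` passes the Armijo
test. If backtracking occurred, the previous trial failed and so exceeded that threshold; the
accepted step is `δ` times it. -/
theorem le_stepLength (h : IsNewtonStep Φ F γ τ δ μ T x Δ m) (hΦ : BregmanBounds c L Φ F)
    (hL : 0 < L) (hδ : δ ∈ Set.Ioo (0 : ℝ) 1) (hμ : μ < 1)
    (hT : ∀ v, c * ‖v‖ ^ 2 ≤ ⟪T v, v⟫_ℝ) :
    min 1 (δ * (2 * (1 - μ) * c / L)) ≤ δ ^ m := by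
  cases m with
  | zero => simp
  | succ m =>
    refine (min_le_right _ _).trans ?_
    rw [pow_succ']
    refine mul_le_mul_of_nonneg_left ?_ hδ.1.le
    have hnot : ¬ (Φ (x + δ ^ m • Δ) ≤ Φ x + μ * δ ^ m * ⟪F x, Δ⟫_ℝ) := fun hm => by
      have := h.armijo.2 hm
      omega
    have h1 := (hΦ x (x + δ ^ m • Δ)).2
    have ht : 0 < δ ^ m := pow_pos hδ.1 m
    set t := δ ^ m
    rw [add_sub_cancel_left, inner_smul_right, norm_smul, Real.norm_of_nonneg ht.le] at h1
    have h2 := h.inner_le hT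
    rw [div_le_iff₀ hL]
    by_contra hcon
    apply hnot
    have h3 : t * (L / 2 * t) * ‖Δ‖ ^ 2 ≤ t * ((1 - μ) * c) * ‖Δ‖ ^ 2 := by
      refine mul_le_mul_of_nonneg_right (mul_le_mul_of_nonneg_left ?_ ht.le) (by positivity)
      linarith
    have h4 : (1 - μ) * t * ⟪F x, Δ⟫_ℝ ≤ (1 - μ) * t * -(c * ‖Δ‖ ^ 2) :=
      mul_le_mul_of_nonneg_left h2 (mul_nonneg (by linarith) ht.le)
    nlinarith

end IsNewtonStep

variable {c L : ℝ} {Φ : E → ℝ} {F : E → E} {γ τ δ μ : ℝ}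

theorem tendsto_of_isNewtonStep (hc : 0 < c) (hL : 0 < L) (hΦ : BregmanBounds c L Φ F)
    (hγ : γ ∈ Set.Ioo (0 : ℝ) 1) (hτ : 0 < τ) (hδ : δ ∈ Set.Ioo (0 : ℝ) 1)
    (hμ : μ ∈ Set.Ioo (0 : ℝ) (1 / 2)) {z Δ : ℕ → E} {T : ℕ → E →ₗ[ℝ] E} {m : ℕ → ℕ}
    (hT : ∀ j v, c * ‖v‖ ^ 2 ≤ ⟪T j v, v⟫_ℝ) (hT' : ∀ j v, ‖T j v‖ ≤ L * ‖v‖)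
    (hstep : ∀ j, IsNewtonStep Φ F γ τ δ μ (T j) (z j) (Δ j) (m j))
    (hz : ∀ j, z (j + 1) = z j + δ ^ m j • Δ j) {zbar : E} (hbar : F zbar = 0) :
    Tendsto z atTop (𝓝 zbar) := by
  set κ := γ ^ (τ / (1 + τ))
  have hκ : κ < 1 := Real.rpow_lt_one hγ.1.le hγ.2 (by positivity)
  set t₀ := min 1 (δ * (2 * (1 - μ) * c / L)) with ht₀_def
  have ht₀ : 0 < t₀ := lt_min one_pos (mul_pos hδ.1 (div_pos (mul_pos (mul_pos two_pos
    (by linarith [hμ.2])) hc) hL))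
  -- Armijo with step at least `t₀` gives a decrease of `μ * t₀ * c * ‖Δ‖ ^ 2`, and `L * ‖Δ‖ ≥ (1 -
  -- κ) * ‖F z‖ ≥ (1 - κ) * c * ‖z - zbar‖`.
  have hdesc : ∀ j, μ * t₀ * c * ((1 - κ) * c / L) ^ 2 * ‖z j - zbar‖ ^ 2 ≤
      Φ (z j) - Φ (z (j + 1)) := by
    intro j
    have h1 := (hstep j).armijo.1
    rw [Set.mem_ofPred_eq, ← hz j] at h1
    have h2 := (hstep j).inner_le (hT j)
    have h3 := (hstep j).norm_le hγ.1 hτ (hT' j)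
    have h4 := (hstep j).le_stepLength hΦ hL hδ (by linarith [hμ.2]) (hT j)
    have h5 := hΦ.norm_sub_le hbar (z j)
    have h6 : (1 - κ) * c / L * ‖z j - zbar‖ ≤ ‖Δ j‖ := by
      rw [div_mul_eq_mul_div, div_le_iff₀ hL, mul_assoc, mul_comm ‖Δ j‖]
      exact (mul_le_mul_of_nonneg_left h5 (by linarith)).trans h3
    have h7 : ((1 - κ) * c / L * ‖z j - zbar‖) ^ 2 ≤ ‖Δ j‖ ^ 2 := by
      apply pow_le_pow_left₀ _ h6
      have : 0 ≤ 1 - κ := by linarith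
      positivity
    calc μ * t₀ * c * ((1 - κ) * c / L) ^ 2 * ‖z j - zbar‖ ^ 2
        = μ * t₀ * (c * ((1 - κ) * c / L * ‖z j - zbar‖) ^ 2) := by ring
      _ ≤ μ * δ ^ m j * (c * ‖Δ j‖ ^ 2) := by
        have := hμ.1
        have := hδ.1
        gcongr
      _ ≤ μ * δ ^ m j * -⟪F (z j), Δ j⟫_ℝ := by
        apply mul_le_mul_of_nonneg_left (by linarith)
        exact mul_nonneg hμ.1.le (pow_nonneg hδ.1.le _)
      _ ≤ Φ (z j) - Φ (z (j + 1)) := by linarith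
  set ω := μ * t₀ * c * ((1 - κ) * c / L) ^ 2
  have hω : 0 < ω := by
    have := hμ.1
    have : 0 < 1 - κ := by linarith
    positivity
  have hanti : Antitone fun j => Φ (z j) := antitone_nat_of_succ_le fun j => by
    have := hdesc j
    have : 0 ≤ ω * ‖z j - zbar‖ ^ 2 := by positivity
    linarith
  have hbdd : BddBelow (Set.range fun j => Φ (z j)) := by
    refine ⟨Φ zbar, ?_⟩
    rintro _ ⟨j, rfl⟩
    have h1 := (hΦ zbar (z j)).1
    rw [hbar, inner_zero_left] at h1
    have : 0 ≤ c / 2 * ‖z j - zbar‖ ^ 2 := by positivity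
    show Φ zbar ≤ Φ (z j)
    linarith
  have hlim := tendsto_atTop_ciInf hanti hbdd
  have hdiff := hlim.sub (hlim.comp (tendsto_add_atTop_nat 1))
  rw [sub_self] at hdiff
  have hsq : Tendsto (fun j => ‖z j - zbar‖ ^ 2) atTop (𝓝 0) := by
    have h1 : Tendsto (fun j => ω * ‖z j - zbar‖ ^ 2) atTop (𝓝 0) :=
      squeeze_zero (fun j => by positivity) hdesc hdiff
    simpa [hω.ne'] using h1.const_mul ω⁻¹
  rw [tendsto_iff_norm_sub_tendsto_zero]
  have h2 := (Real.continuous_sqrt.tendsto 0).comp hsq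
  simpa [Function.comp_def, Real.sqrt_sq (norm_nonneg _)] using h2

/-- Near the solution, the full Newton step is accepted and reduces the error to
`O(‖x - zbar‖ ^ (1 + τ))`. -/
theorem exists_forall_isNewtonStep (hc : 0 < c) (hL : 0 < L) (hΦ : BregmanBounds c L Φ F)
    (hτ : τ ∈ Set.Ioc (0 : ℝ) 1) (hμ : μ ∈ Set.Ioo (0 : ℝ) (1 / 2))
    {K : E → Set (E →ₗ[ℝ] E)}
    (hK : ∀ x, ∀ T ∈ K x, ∀ v, c * ‖v‖ ^ 2 ≤ ⟪T v, v⟫_ℝ ∧ ‖T v‖ ≤ L * ‖v‖)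
    {zbar : E} (hbar : F zbar = 0)
    (hsemi : ∃ C, ∃ ε > 0, ∀ h, ‖h‖ < ε → ∀ T ∈ K (zbar + h),
      ‖F (zbar + h) - F zbar - T h‖ ≤ C * ‖h‖ ^ 2)
    (hquad : ∃ C, ∃ ε > 0, ∀ h, ‖h‖ < ε → 1 / 2 * ⟪F (zbar + h) - F zbar, h⟫_ℝ - C * ‖h‖ ^ 3 ≤
      Φ (zbar + h) - Φ zbar - ⟪F zbar, h⟫_ℝ) :
    ∃ N, ∀ᶠ x in 𝓝 zbar, ∀ T ∈ K x, ∀ Δ m, IsNewtonStep Φ F γ τ δ μ T x Δ m →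
      ‖x + δ ^ m • Δ - zbar‖ ≤ N * ‖x - zbar‖ ^ (1 + τ) := by
  obtain ⟨C₁, ε₁, hε₁, hsemi⟩ := hsemi
  obtain ⟨C₂, ε₂, hε₂, hquad⟩ := hquad
  set C := max 0 (max C₁ C₂)
  have hC0 : 0 ≤ C := le_max_left _ _
  have hC₁ : C₁ ≤ C := (le_max_left _ _).trans (le_max_right _ _)
  have hC₂ : C₂ ≤ C := (le_max_right _ _).trans (le_max_right _ _)
  -- `M` bounds `‖F x‖ / ‖x - zbar‖` near `zbar`. In `N`, `C` comes from semismoothness, `M ^ (1 +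
  -- τ)` from the residual tolerance, and `1 / c` from inverting `T`.
  set M := L + C
  have hM : 0 < M := by positivity
  set N := (C + M ^ (1 + τ)) / c
  have hN : 0 ≤ N := by positivity
  refine ⟨N, ?_⟩
  have hlim : Tendsto (fun x : E => ‖x - zbar‖) (𝓝 zbar) (𝓝 0) := by
    have : Continuous fun y => ‖y - zbar‖ := by fun_prop
    simpa using this.tendsto zbar
  -- The three summands are the errors in the Armijo test of the full step: the cubic trapezoid
  -- error, the term `⟪F x, e + Δ⟫`, and the value of `Φ` at the new point. Their sum must fall
  -- below the margin `(1 / 2 - μ) * c`.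
  have hlimτ : Tendsto (fun x : E => (C + M * N + L / 2 * N ^ 2) * ‖x - zbar‖ ^ τ)
      (𝓝 zbar) (𝓝 0) := by
    have h1 := (hlim.rpow_const (p := τ) (Or.inr hτ.1.le)).const_mul (C + M * N + L / 2 * N ^ 2)
    simpa [Real.zero_rpow hτ.1.ne'] using h1
  have hsmall : 0 < (1 / 2 - μ) * c := mul_pos (by linarith [hμ.2]) hc
  filter_upwards [hlim.eventually_lt_const hε₁, hlim.eventually_lt_const hε₂,
    hlim.eventually_lt_const one_pos, hlimτ.eventually_lt_const hsmall] with x hx₁ hx₂ hx₃ hx₄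
  intro T hT Δ m hstep
  obtain ⟨e, rfl⟩ : ∃ e, x = zbar + e := ⟨x - zbar, by abel⟩
  rw [add_sub_cancel_left] at *
  have hs := hsemi e hx₁ T hT
  have hq := hquad e hx₂
  rw [hbar, sub_zero] at hs
  rw [hbar, sub_zero, inner_zero_left, sub_zero] at hq
  have he : 0 ≤ ‖e‖ := norm_nonneg e
  set r := ‖e‖ ^ τ
  have hr0 : 0 ≤ r := Real.rpow_nonneg he _
  have hr1 : r ≤ 1 := Real.rpow_le_one he hx₃.le hτ.1.le
  have her : ‖e‖ ≤ r := by
    simpa using Real.rpow_le_rpow_of_exponent_ge_of_imp he hx₃.le hτ.2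
      (fun _ h => absurd h one_ne_zero)
  have hpow : ‖e‖ ^ (1 + τ) = ‖e‖ * r := by
    rw [Real.rpow_add' he (by linarith [hτ.1]), Real.rpow_one]
  have hs' : ‖F (zbar + e) - T e‖ ≤ C * ‖e‖ ^ 2 :=
    hs.trans (mul_le_mul_of_nonneg_right hC₁ (by positivity))
  have hFn : ‖F (zbar + e)‖ ≤ M * ‖e‖ := by
    have h1 : ‖F (zbar + e)‖ ≤ ‖F (zbar + e) - T e‖ + ‖T e‖ := by
      simpa using norm_add_le (F (zbar + e) - T e) (T e)
    have h2 := (hK _ T hT e).2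
    have h3 : C * ‖e‖ ^ 2 ≤ C * ‖e‖ := by
      apply mul_le_mul_of_nonneg_left _ hC0
      nlinarith
    have : M * ‖e‖ = L * ‖e‖ + C * ‖e‖ := add_mul _ _ _
    linarith
  have hRn : ‖T Δ + F (zbar + e)‖ ≤ M ^ (1 + τ) * (‖e‖ * r) := by
    refine hstep.residual.trans ((min_le_right _ _).trans ?_)
    rw [← hpow, ← Real.mul_rpow hM.le he]
    exact Real.rpow_le_rpow (norm_nonneg _) hFn (by linarith [hτ.1])
  have hTinv : ∀ v, c * ‖v‖ ≤ ‖T v‖ := by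
    intro v
    rcases (norm_nonneg v).eq_or_lt with h0 | h0
    · rw [← h0]; simp
    · have h1 := ((hK _ T hT v).1).trans (real_inner_le_norm _ _)
      exact le_of_mul_le_mul_right (by nlinarith) h0
  have hplus : ‖e + Δ‖ ≤ N * (‖e‖ * r) := by
    -- The new error, mapped by `T`, is the linear-system residual minus the semismooth remainder.
    have h1 : T (e + Δ) = (T Δ + F (zbar + e)) - (F (zbar + e) - T e) := by
      rw [map_add]; abel
    have h2 : ‖T (e + Δ)‖ ≤ M ^ (1 + τ) * (‖e‖ * r) + C * ‖e‖ ^ 2 := by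
      rw [h1]
      exact (norm_sub_le _ _).trans (add_le_add hRn hs')
    have h3 : C * ‖e‖ ^ 2 ≤ C * (‖e‖ * r) := by
      rw [sq]; gcongr
    have h4 := hTinv (e + Δ)
    rw [show N * (‖e‖ * r) = (C + M ^ (1 + τ)) * (‖e‖ * r) / c by
      simp only [N]; ring, le_div_iff₀ hc]
    linarith
  -- Relative to `Φ zbar`, the new value is at most `L / 2 * ‖e + Δ‖ ^ 2` and the old one at least
  -- `1 / 2 * ⟪F, e⟫` up to a cubic error, while `⟪F, Δ⟫` is nearly `-⟪F, e⟫`. This leaves `(1 / 2 -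
  -- μ) * ⟪F, e⟫ ≥ (1 / 2 - μ) * c * ‖e‖ ^ 2` to absorb all errors.
  have hm : m = 0 := by
    have hmem : Φ (zbar + e + δ ^ 0 • Δ) ≤
        Φ (zbar + e) + μ * δ ^ 0 * ⟪F (zbar + e), Δ⟫_ℝ := by
      rw [pow_zero, one_smul, mul_one]
      have h1 := (hΦ zbar (zbar + e + Δ)).2
      rw [hbar, inner_zero_left, sub_zero, add_assoc, add_sub_cancel_left, ← add_assoc] at h1
      have h2 : ⟪F (zbar + e), Δ⟫_ℝ = ⟪F (zbar + e), e + Δ⟫_ℝ - ⟪F (zbar + e), e⟫_ℝ := by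
        rw [inner_add_right]; ring
      have h3 : -(M * ‖e‖ * (N * (‖e‖ * r))) ≤ ⟪F (zbar + e), e + Δ⟫_ℝ := by
        have := neg_abs_le ⟪F (zbar + e), e + Δ⟫_ℝ
        have h4 := (abs_real_inner_le_norm (F (zbar + e)) (e + Δ)).trans
          (mul_le_mul hFn hplus (norm_nonneg _) (by positivity))
        linarith
      have h5 := hΦ.le_inner hbar (zbar + e)
      rw [add_sub_cancel_left] at h5
      have h6 : L / 2 * ‖e + Δ‖ ^ 2 ≤ L / 2 * N ^ 2 * r * ‖e‖ ^ 2 := by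
        have h7 : ‖e + Δ‖ ^ 2 ≤ (N * (‖e‖ * r)) ^ 2 := pow_le_pow_left₀ (norm_nonneg _) hplus 2
        have h8 : (N * (‖e‖ * r)) ^ 2 ≤ N ^ 2 * r * ‖e‖ ^ 2 := by
          have : r ^ 2 ≤ r := by nlinarith
          calc (N * (‖e‖ * r)) ^ 2 = N ^ 2 * r ^ 2 * ‖e‖ ^ 2 := by ring
            _ ≤ _ := by gcongr
        calc L / 2 * ‖e + Δ‖ ^ 2 ≤ L / 2 * (N ^ 2 * r * ‖e‖ ^ 2) := by
              apply mul_le_mul_of_nonneg_left (h7.trans h8) (by positivity)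
          _ = _ := by ring
      have h9 : C₂ * ‖e‖ ^ 3 ≤ C * r * ‖e‖ ^ 2 := by
        calc C₂ * ‖e‖ ^ 3 ≤ C * ‖e‖ ^ 3 := by gcongr
          _ = C * ‖e‖ * ‖e‖ ^ 2 := by ring
          _ ≤ _ := by gcongr
      have h10 : (C + M * N + L / 2 * N ^ 2) * r * ‖e‖ ^ 2 ≤ (1 / 2 - μ) * c * ‖e‖ ^ 2 := by
        gcongr
      have h11 : (1 / 2 - μ) * (c * ‖e‖ ^ 2) ≤ (1 / 2 - μ) * ⟪F (zbar + e), e⟫_ℝ :=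
        mul_le_mul_of_nonneg_left h5 (by linarith [hμ.2])
      have h12 : -(M * N * r * ‖e‖ ^ 2) ≤ μ * ⟪F (zbar + e), e + Δ⟫_ℝ := by
        have h13 : 0 ≤ M * N * r * ‖e‖ ^ 2 := by positivity
        have h14 := mul_le_mul_of_nonneg_left h3 hμ.1.le
        have h15 : μ * (M * N * r * ‖e‖ ^ 2) ≤ 1 * (M * N * r * ‖e‖ ^ 2) := by
          apply mul_le_mul_of_nonneg_right (by linarith [hμ.2]) h13
        linarith
      rw [h2]
      linarith
    exact Nat.le_zero.mp (hstep.armijo.2 hmem)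
  rw [hm, pow_zero, one_smul, hpow, add_assoc, add_sub_cancel_left]
  exact hplus

/-- Convergence of a globalized inexact generalized Newton method for a strongly convex function:
the iterates converge to the unique minimizer with order `1 + τ`. -/
theorem newton_convergence [FiniteDimensional ℝ E] (hc : 0 < c) (hL : 0 < L) (hΦ : BregmanBounds c L Φ F)
    (hγ : γ ∈ Set.Ioo (0 : ℝ) 1) (hτ : τ ∈ Set.Ioc (0 : ℝ) 1) (hδ : δ ∈ Set.Ioo (0 : ℝ) 1)
    (hμ : μ ∈ Set.Ioo (0 : ℝ) (1 / 2)) {K : E → Set (E →ₗ[ℝ] E)}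
    (hK : ∀ x, ∀ T ∈ K x, ∀ v, c * ‖v‖ ^ 2 ≤ ⟪T v, v⟫_ℝ ∧ ‖T v‖ ≤ L * ‖v‖)
    (hsemi : ∀ x, ∃ C, ∃ ε > 0, ∀ h, ‖h‖ < ε → ∀ T ∈ K (x + h),
      ‖F (x + h) - F x - T h‖ ≤ C * ‖h‖ ^ 2)
    (hquad : ∀ x, ∃ C, ∃ ε > 0, ∀ h, ‖h‖ < ε →
      1 / 2 * ⟪F (x + h) - F x, h⟫_ℝ - C * ‖h‖ ^ 3 ≤ Φ (x + h) - Φ x - ⟪F x, h⟫_ℝ)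
    {z : ℕ → E} (hz : ∀ j, ∃ T ∈ K (z j), ∃ Δ m,
      IsNewtonStep Φ F γ τ δ μ T (z j) Δ m ∧ z (j + 1) = z j + δ ^ m • Δ) :
    ∃ zbar : E,
      (∀ w, Φ zbar ≤ Φ w) ∧
      (∀ y, (∀ w, Φ y ≤ Φ w) → y = zbar) ∧
      Tendsto z atTop (𝓝 zbar) ∧
      (fun j => ‖z (j + 1) - zbar‖) =O[atTop] (fun j => ‖z j - zbar‖ ^ (1 + τ)) ∧
      (fun j => ‖z (j + 1) - zbar‖) =o[atTop] (fun j => ‖z j - zbar‖) ∧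
      (τ = 1 → (fun j => ‖z (j + 1) - zbar‖) =O[atTop] (fun j => ‖z j - zbar‖ ^ 2)) := by
  obtain ⟨zbar, hbar⟩ := hΦ.exists_zero hc hL
  have hlow : ∀ w, Φ zbar + c / 2 * ‖w - zbar‖ ^ 2 ≤ Φ w := by
    intro w
    have h1 := (hΦ zbar w).1
    rw [hbar, inner_zero_left] at h1
    linarith
  choose T hTK Δ m hstep hnext using hz
  have hlim : Tendsto z atTop (𝓝 zbar) :=
    tendsto_of_isNewtonStep hc hL hΦ hγ hτ.1 hδ hμ (fun j v => (hK _ _ (hTK j) v).1)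
      (fun j v => (hK _ _ (hTK j) v).2) hstep hnext hbar
  have hO : (fun j => ‖z (j + 1) - zbar‖) =O[atTop] (fun j => ‖z j - zbar‖ ^ (1 + τ)) := by
    obtain ⟨N, hN⟩ := exists_forall_isNewtonStep (γ := γ) (δ := δ) hc hL hΦ hτ hμ hK hbar
      (hsemi zbar) (hquad zbar)
    refine IsBigO.of_bound N ?_
    filter_upwards [hlim.eventually hN] with j hj
    rw [norm_norm, Real.norm_of_nonneg (Real.rpow_nonneg (norm_nonneg _) _), hnext j]
    exact hj (T j) (hTK j) (Δ j) (m j) (hstep j)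
  refine ⟨zbar, ?_, ?_, hlim, hO, ?_, ?_⟩
  · intro w
    have h1 : 0 ≤ c / 2 * ‖w - zbar‖ ^ 2 := by positivity
    linarith [hlow w]
  · intro y hy
    have h1 : c / 2 * ‖y - zbar‖ ^ 2 ≤ 0 := by linarith [hlow y, hy zbar]
    by_contra hne
    have h2 : 0 < ‖y - zbar‖ := norm_pos_iff.mpr (sub_ne_zero.mpr hne)
    have h3 : 0 < c / 2 * ‖y - zbar‖ ^ 2 := by positivity
    linarith
  · refine hO.trans_isLittleO ?_
    have h0 : Tendsto (fun j => ‖z j - zbar‖) atTop (𝓝 0) :=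
      tendsto_iff_norm_sub_tendsto_zero.mp hlim
    have h1 : (fun j => ‖z j - zbar‖ ^ τ) =o[atTop] fun _ => (1 : ℝ) := by
      rw [isLittleO_one_iff]
      simpa [Real.zero_rpow hτ.1.ne'] using h0.rpow_const (p := τ) (Or.inr hτ.1.le)
    have h2 := (isBigO_refl (fun j => ‖z j - zbar‖) atTop).mul_isLittleO h1
    refine (h2.congr_left fun j => ?_).congr_right fun j => mul_one _
    rw [Real.rpow_add' (norm_nonneg _) (by linarith [hτ.1]), Real.rpow_one]
  · rintro rfl
    refine hO.congr_right fun j => ?_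
    norm_num

end Newton

/-! ### Projections onto closed convex sets -/

section Projection

variable {E : Type*} [NormedAddCommGroup E]

theorem proxObjective_indicatorFn_of_mem {C : Set E} {y : E} (hy : y ∈ C) (x : E) :
    proxObjective (indicatorFn C) x y = ((1 / 2 * ‖y - x‖ ^ 2 : ℝ) : EReal) := by
  simp [proxObjective, indicatorFn, hy]

theorem proxObjective_indicatorFn_of_notMem {C : Set E} {y : E} (hy : y ∉ C) (x : E) :
    proxObjective (indicatorFn C) x y = ⊤ := by
  simp only [proxObjective, indicatorFn, hy, if_false]
  exact EReal.top_add_coe _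

variable [InnerProductSpace ℝ E]

/-- `π` maps each point to its metric projection onto `C`, given by the variational inequality. -/
def IsProjection (C : Set E) (π : E → E) : Prop :=
  ∀ x, π x ∈ C ∧ ∀ w ∈ C, ⟪x - π x, w - π x⟫_ℝ ≤ 0

theorem prox_indicatorFn_le [CompleteSpace E] {C : Set E} (hne : C.Nonempty) (hcl : IsClosed C)
    (hcv : Convex ℝ C) (x w : E) :
    proxObjective (indicatorFn C) x (prox (indicatorFn C) x) ≤
      proxObjective (indicatorFn C) x w := by
  refine Classical.epsilon_spec
    (p := fun y => ∀ w, proxObjective (indicatorFn C) x y ≤ proxObjective (indicatorFn C) x w)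
    ?_ w
  obtain ⟨v, hv, hmin⟩ := exists_norm_eq_iInf_of_complete_convex hne hcl.isComplete hcv x
  refine ⟨v, fun w => ?_⟩
  by_cases hw : w ∈ C
  · rw [proxObjective_indicatorFn_of_mem hv, proxObjective_indicatorFn_of_mem hw,
      EReal.coe_le_coe_iff, norm_sub_rev v, norm_sub_rev w, hmin]
    have h1 : ⨅ u : C, ‖x - u‖ ≤ ‖x - w‖ :=
      ciInf_le ⟨0, by rintro _ ⟨u, rfl⟩; exact norm_nonneg _⟩ (⟨w, hw⟩ : C)
    have h0 : 0 ≤ ⨅ u : C, ‖x - u‖ := hmin ▸ norm_nonneg _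
    gcongr
  · rw [proxObjective_indicatorFn_of_notMem hw]
    exact le_top

theorem isProjection_prox [CompleteSpace E] {C : Set E} (hne : C.Nonempty) (hcl : IsClosed C)
    (hcv : Convex ℝ C) : IsProjection C (prox (indicatorFn C)) := by
  intro x
  have hle := prox_indicatorFn_le hne hcl hcv x
  have hmem : prox (indicatorFn C) x ∈ C := by
    by_contra hcon
    obtain ⟨v, hv⟩ := hne
    have := hle v
    rw [proxObjective_indicatorFn_of_notMem hcon, proxObjective_indicatorFn_of_mem hv] at this
    exact EReal.coe_ne_top _ (top_le_iff.mp this)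
  refine ⟨hmem, (norm_eq_iInf_iff_real_inner_le_zero hcv hmem).mp ?_⟩
  have : Nonempty C := ⟨⟨_, hmem⟩⟩
  refine le_antisymm (le_ciInf fun w => ?_)
    (ciInf_le ⟨0, by rintro _ ⟨u, rfl⟩; exact norm_nonneg _⟩
      (⟨prox (indicatorFn C) x, hmem⟩ : C))
  have h1 := hle w
  rw [proxObjective_indicatorFn_of_mem hmem, proxObjective_indicatorFn_of_mem w.2,
    EReal.coe_le_coe_iff, norm_sub_rev _ x, norm_sub_rev _ x] at h1
  exact (sq_le_sq₀ (norm_nonneg _) (norm_nonneg _)).mp (by linarith)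

theorem moreauEnvelope_indicatorFn [CompleteSpace E] {C : Set E} (hne : C.Nonempty)
    (hcl : IsClosed C) (hcv : Convex ℝ C) (x : E) :
    moreauEnvelope (indicatorFn C) x = 1 / 2 * ‖x - prox (indicatorFn C) x‖ ^ 2 := by
  have h : ⨅ y, proxObjective (indicatorFn C) x y =
      proxObjective (indicatorFn C) x (prox (indicatorFn C) x) :=
    le_antisymm (iInf_le _ _) (le_iInf fun w => prox_indicatorFn_le hne hcl hcv x w)
  rw [moreauEnvelope, h, proxObjective_indicatorFn_of_mem (isProjection_prox hne hcl hcv x).1,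
    EReal.toReal_coe, norm_sub_rev]

namespace IsProjection

variable {C : Set E} {π : E → E}

theorem eq_of_mem (h : IsProjection C π) {x y : E} (hy : y ∈ C)
    (hvar : ∀ w ∈ C, ⟪x - y, w - y⟫_ℝ ≤ 0) : π x = y := by
  have h1 := (h x).2 y hy
  have h2 := hvar _ (h x).1
  have h3 : ⟪π x - y, π x - y⟫_ℝ ≤ 0 := by
    have e1 : ⟪x - π x, y - π x⟫_ℝ = ⟪(π x - y) - (x - y), π x - y⟫_ℝ := by
      rw [← neg_sub (π x) y, inner_neg_right, ← inner_neg_left]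
      congr 1; abel
    rw [e1, inner_sub_left] at h1
    linarith
  rw [real_inner_self_eq_norm_sq] at h3
  exact sub_eq_zero.mp (norm_eq_zero.mp (pow_eq_zero_iff two_ne_zero |>.mp
    (le_antisymm h3 (by positivity))))

/-- Firm nonexpansiveness, the sum of the variational inequalities at `x` and `y`. -/
theorem norm_sq_le_inner (h : IsProjection C π) (x y : E) :
    ‖π x - π y‖ ^ 2 ≤ ⟪π x - π y, x - y⟫_ℝ := by
  have h1 := (h x).2 _ (h y).1
  have h2 := (h y).2 _ (h x).1
  have e1 : ⟪x - π x, π y - π x⟫_ℝ = -⟪π x - π y, x - π x⟫_ℝ := by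
    rw [← neg_sub (π x) (π y), inner_neg_right, real_inner_comm]
  have e2 : ⟪y - π y, π x - π y⟫_ℝ = ⟪π x - π y, y - π y⟫_ℝ := real_inner_comm _ _
  have e3 : ⟪π x - π y, x - y⟫_ℝ = ⟪π x - π y, x - π x⟫_ℝ - ⟪π x - π y, y - π y⟫_ℝ +
      ⟪π x - π y, π x - π y⟫_ℝ := by
    rw [← inner_sub_right, ← inner_add_right]
    congr 1; abel
  rw [e3, real_inner_self_eq_norm_sq]
  linarith

theorem lipschitzWith (h : IsProjection C π) : LipschitzWith 1 π := by
  refine LipschitzWith.of_dist_le_mul fun x y => ?_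
  rw [dist_eq_norm, dist_eq_norm, NNReal.coe_one, one_mul]
  rcases (norm_nonneg (π x - π y)).eq_or_lt with h0 | h0
  · rw [← h0]; exact norm_nonneg _
  · have h1 := (h.norm_sq_le_inner x y).trans (real_inner_le_norm _ _)
    exact le_of_mul_le_mul_left (by nlinarith) h0

/-- The lower bound is the variational inequality at `x` tested with `π y`. The upper one holds
because `π x` is a competitor in the projection of `y`. -/
theorem bregmanBounds (h : IsProjection C π) :
    BregmanBounds 0 1 (fun x => 1 / 2 * ‖x - π x‖ ^ 2) (fun x => x - π x) := by
  intro x y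
  have e0 : y - π y = (x - π x) + ((y - x) + (π x - π y)) := by abel
  have e1 : ‖y - π y‖ ^ 2 = ‖x - π x‖ ^ 2 + 2 * (⟪x - π x, y - x⟫_ℝ + ⟪x - π x, π x - π y⟫_ℝ) +
      ‖(y - x) + (π x - π y)‖ ^ 2 := by
    rw [e0, norm_add_sq_real, inner_add_right]
  have h1 : 0 ≤ ⟪x - π x, π x - π y⟫_ℝ := by
    have := (h x).2 _ (h y).1
    rw [← neg_sub (π x) (π y), inner_neg_right] at this
    linarith
  constructor
  · have : 0 ≤ ‖(y - x) + (π x - π y)‖ ^ 2 := by positivity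
    dsimp only
    linarith
  · have e2 : y - π x = (y - π y) + -(π x - π y) := by abel
    have e3 : ‖y - π x‖ ^ 2 = ‖y - π y‖ ^ 2 + 2 * ⟪y - π y, -(π x - π y)⟫_ℝ +
        ‖-(π x - π y)‖ ^ 2 := by
      rw [e2, norm_add_sq_real]
    have e4 : ‖y - π x‖ ^ 2 = ‖x - π x‖ ^ 2 + 2 * ⟪x - π x, y - x⟫_ℝ + ‖y - x‖ ^ 2 := by
      rw [show y - π x = (x - π x) + (y - x) by abel, norm_add_sq_real]
    have h2 := (h y).2 _ (h x).1
    rw [inner_neg_right] at e3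
    have : 0 ≤ ‖-(π x - π y)‖ ^ 2 := by positivity
    dsimp only
    linarith

end IsProjection

end Projection

/-! ### Clarke Jacobians of projections -/

/-- Directional differentiability yields only right derivatives along rays, which is all that the
mean value inequality used below requires. -/
theorem hasDerivWithinAt_Ici_of_directional {E : Type*} [NormedAddCommGroup E]
    [NormedSpace ℝ E] {F : E → E} {x e L : E} {t : ℝ}
    (hL : Tendsto (fun s : ℝ => s⁻¹ • (F (x + t • e + s • e) - F (x + t • e))) (𝓝[>] 0) (𝓝 L)) :
    HasDerivWithinAt (fun s : ℝ => F (x + s • e)) L (Set.Ici t) t := by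
  rw [← hasDerivWithinAt_Ioi_iff_Ici, hasDerivWithinAt_iff_tendsto_slope' (by simp)]
  have h1 : Tendsto (fun s : ℝ => s - t) (𝓝[>] t) (𝓝[>] 0) := by
    refine tendsto_nhdsWithin_iff.mpr ⟨?_, ?_⟩
    · have : Continuous fun s : ℝ => s - t := by fun_prop
      simpa using (this.tendsto t).mono_left nhdsWithin_le_nhds
    · filter_upwards [self_mem_nhdsWithin] with s hs
      exact sub_pos.mpr (Set.mem_Ioi.mp hs)
  refine (hL.comp h1).congr fun s => ?_
  simp only [Function.comp_apply, slope, vsub_eq_sub]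
  rw [add_assoc, ← add_smul, add_sub_cancel]

section Clarke

variable {ι : Type*} [Fintype ι] [DecidableEq ι]

theorem continuous_toEuclideanLin_apply (v : EuclideanSpace ℝ ι) :
    Continuous fun V : Matrix ι ι ℝ => Matrix.toEuclideanLin V v :=
  LinearMap.continuous_of_finiteDimensional
    (LinearMap.applyₗ v ∘ₗ (Matrix.toEuclideanLin (𝕜 := ℝ) (m := ι) (n := ι)).toLinearMap)

/-- By Rademacher's theorem differentiability points are dense, and the Lipschitz constant bounds
the derivatives there, so a subsequence of them converges. -/
theorem clarkeJacobian_nonempty {F : EuclideanSpace ℝ ι → EuclideanSpace ℝ ι} {K : NNReal}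
    (hF : LipschitzWith K F) (x : EuclideanSpace ℝ ι) : (clarkeJacobian F x).Nonempty := by
  have hdense : Dense {y | DifferentiableAt ℝ F y} :=
    MeasureTheory.Measure.dense_of_ae (hF.ae_differentiableAt (μ := MeasureTheory.volume))
  obtain ⟨u, hu, hux⟩ := mem_closure_iff_seq_limit.mp (hdense x)
  obtain ⟨A, -, φ, hφ, hA⟩ := tendsto_subseq_of_bounded
    (Metric.isBounded_closedBall (x := (0 : EuclideanSpace ℝ ι →L[ℝ] EuclideanSpace ℝ ι))
      (r := K)) (x := fun k => fderiv ℝ F (u k))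
    (fun k => by simpa using norm_fderiv_le_of_lipschitz ℝ hF)
  let e := (Matrix.toEuclideanCLM (n := ι) (𝕜 := ℝ)).symm
  have he : Continuous e := by
    exact LinearMap.continuous_of_finiteDimensional
      ((Matrix.toEuclideanCLM (n := ι) (𝕜 := ℝ)).toAlgEquiv.toLinearEquiv.symm.toLinearMap)
  refine ⟨e A, subset_convexHull ℝ _ ⟨u ∘ φ, fun k => e (fderiv ℝ F (u (φ k))),
    hux.comp hφ.tendsto_atTop, fun k => ?_, (he.tendsto A).comp hA⟩⟩
  simp only [e, StarAlgEquiv.apply_symm_apply]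
  exact DifferentiableAt.hasFDerivAt (hu (φ k))

theorem toEuclideanCLM_apply_eq (J : Matrix ι ι ℝ) (v : EuclideanSpace ℝ ι) :
    Matrix.toEuclideanCLM (n := ι) (𝕜 := ℝ) J v = Matrix.toEuclideanLin J v := rfl

/-- Every element of the Clarke Jacobian of a projection is symmetric, positive semidefinite and
nonexpansive. -/
theorem IsProjection.clarkeJacobian_spec {C : Set (EuclideanSpace ℝ ι)}
    {π : EuclideanSpace ℝ ι → EuclideanSpace ℝ ι} (h : IsProjection C π)
    {x : EuclideanSpace ℝ ι} {Q : Matrix ι ι ℝ} (hQ : Q ∈ clarkeJacobian π x) :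
    Q.IsHermitian ∧ ∀ v, 0 ≤ ⟪Matrix.toEuclideanLin Q v, v⟫_ℝ ∧
      ‖Matrix.toEuclideanLin Q v‖ ≤ ‖v‖ := by
  suffices hsub : clarkeJacobian π x ⊆ {Q : Matrix ι ι ℝ | ∀ v w,
      ⟪Matrix.toEuclideanLin Q v, w⟫_ℝ = ⟪v, Matrix.toEuclideanLin Q w⟫_ℝ ∧
      0 ≤ ⟪Matrix.toEuclideanLin Q v, v⟫_ℝ ∧ ‖Matrix.toEuclideanLin Q v‖ ≤ ‖v‖} by
    have h1 := hsub hQ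
    exact ⟨Matrix.isSymmetric_toEuclideanLin_iff.mp fun v w => (h1 v w).1, fun v => (h1 v v).2⟩
  refine convexHull_min ?_ ?_
  · rintro V ⟨u, J, -, hJ, hJV⟩ v w
    have hlim : ∀ v, Tendsto (fun k => Matrix.toEuclideanLin (J k) v) atTop
        (𝓝 (Matrix.toEuclideanLin V v)) := fun v =>
      ((continuous_toEuclideanLin_apply v).tendsto V).comp hJV
    have hsymm : ∀ k, ⟪Matrix.toEuclideanLin (J k) v, w⟫_ℝ =
        ⟪v, Matrix.toEuclideanLin (J k) w⟫_ℝ := by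
      intro k
      -- `I - J k` is the second derivative at `u k` of the half squared distance, hence symmetric.
      have h1 : HasFDerivAt (fun y => innerSL ℝ (y - π y))
          ((innerSL ℝ).comp (ContinuousLinearMap.id ℝ _ -
            Matrix.toEuclideanCLM (n := ι) (𝕜 := ℝ) (J k))) (u k) :=
        (innerSL ℝ).hasFDerivAt.comp (u k) ((hasFDerivAt_id (u k)).sub (hJ k))
      have h2 := second_derivative_symmetric
        (fun y => (h.bregmanBounds.hasGradientAt le_rfl y).hasFDerivAt) h1 v w
      have h3 : ⟪v - Matrix.toEuclideanLin (J k) v, w⟫_ℝ =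
          ⟪w - Matrix.toEuclideanLin (J k) w, v⟫_ℝ := h2
      rw [inner_sub_left, inner_sub_left, real_inner_comm v w] at h3
      rw [real_inner_comm (Matrix.toEuclideanLin (J k) w) v]
      linarith
    -- Firm nonexpansiveness of `π`, divided by `t ^ 2`, passes to the derivative as `t ↓ 0`. It
    -- gives both positivity and nonexpansiveness.
    have hfirm : ∀ k, ‖Matrix.toEuclideanLin (J k) v‖ ^ 2 ≤
        ⟪Matrix.toEuclideanLin (J k) v, v⟫_ℝ := by
      intro k
      have h1 := ((hJ k).hasLineDerivAt v).tendsto_slope_zero_right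
      rw [toEuclideanCLM_apply_eq] at h1
      refine le_of_tendsto_of_tendsto ((h1.norm).pow 2) (h1.inner tendsto_const_nhds) ?_
      filter_upwards [self_mem_nhdsWithin] with t ht
      have ht' : (0 : ℝ) < t := ht
      have h2 := h.norm_sq_le_inner (u k + t • v) (u k)
      rw [add_sub_cancel_left, inner_smul_right] at h2
      rw [norm_smul, inner_smul_left, mul_pow, conj_trivial, Real.norm_of_nonneg (by positivity)]
      calc t⁻¹ ^ 2 * ‖π (u k + t • v) - π (u k)‖ ^ 2
          ≤ t⁻¹ ^ 2 * (t * ⟪π (u k + t • v) - π (u k), v⟫_ℝ) := by gcongr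
        _ = _ := by field_simp
    have hfirmV : ‖Matrix.toEuclideanLin V v‖ ^ 2 ≤ ⟪Matrix.toEuclideanLin V v, v⟫_ℝ :=
      le_of_tendsto_of_tendsto' ((hlim v).norm.pow 2) ((hlim v).inner tendsto_const_nhds) hfirm
    refine ⟨tendsto_nhds_unique ((hlim v).inner tendsto_const_nhds)
      ((tendsto_const_nhds.inner (hlim w)).congr fun k => (hsymm k).symm),
      le_trans (by positivity) hfirmV, ?_⟩
    have h1 := hfirmV.trans (real_inner_le_norm _ _)
    rcases (norm_nonneg (Matrix.toEuclideanLin V v)).eq_or_lt with h0 | h0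
    · rw [← h0]; exact norm_nonneg _
    · exact le_of_mul_le_mul_left (by nlinarith) h0
  · intro V hV W hW a b ha hb hab v w
    obtain ⟨h1, h2, h3⟩ := hV v w
    obtain ⟨k1, k2, k3⟩ := hW v w
    simp only [map_add, map_smul, LinearMap.add_apply, LinearMap.smul_apply, inner_add_left,
      inner_add_right, inner_smul_left, inner_smul_right, conj_trivial]
    refine ⟨by rw [h1, k1], by positivity, ?_⟩
    calc _ ≤ a * ‖Matrix.toEuclideanLin V v‖ + b * ‖Matrix.toEuclideanLin W v‖ := by
          refine (norm_add_le _ _).trans (le_of_eq ?_)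
          rw [norm_smul, norm_smul, Real.norm_of_nonneg ha, Real.norm_of_nonneg hb]
      _ ≤ a * ‖v‖ + b * ‖v‖ := by gcongr
      _ = ‖v‖ := by rw [← add_mul, hab, one_mul]

/-- A strongly semismooth map is calm of order two along rays: at `x + t • e`, its directional
derivative `L` along `e` satisfies `F (x + t • e) - F x - t • L = O(‖e‖ ^ 2)`. -/
theorem StronglySemismooth.norm_sub_directional_le
    {F : EuclideanSpace ℝ ι → EuclideanSpace ℝ ι}
    (hF : StronglySemismooth F (clarkeJacobian F)) (hne : ∀ y, (clarkeJacobian F y).Nonempty)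
    {x e L : EuclideanSpace ℝ ι} {C ε t : ℝ}
    (hC : ∀ h : EuclideanSpace ℝ ι, ‖h‖ < ε → ∀ V ∈ clarkeJacobian F (x + h),
      ‖F (x + h) - F x - Matrix.toEuclideanLin V h‖ ≤ C * ‖h‖ ^ 2)
    (hte : ‖t • e‖ < ε)
    (hL : Tendsto (fun s : ℝ => s⁻¹ • (F (x + t • e + s • e) - F (x + t • e))) (𝓝[>] 0) (𝓝 L)) :
    ‖F (x + t • e) - F x - t • L‖ ≤ C * ‖t • e‖ ^ 2 := by
  choose V hV using hne
  have hcont : Continuous F := hF.1.continuous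
  obtain ⟨-, C', ε', hε', hC'⟩ := hF.2 (x + t • e)
  have hpos : ∀ᶠ s : ℝ in 𝓝[>] 0, 0 < s := self_mem_nhdsWithin
  have hid : Tendsto (fun s : ℝ => s) (𝓝[>] 0) (𝓝 0) := tendsto_id.mono_left nhdsWithin_le_nhds
  have hsmall : ∀ᶠ s : ℝ in 𝓝[>] 0, ‖s • e‖ < ε' := by
    have h1 : Tendsto (fun s : ℝ => ‖s • e‖) (𝓝[>] 0) (𝓝 0) := by
      simpa using (hid.smul_const e).norm
    exact h1.eventually_lt_const hε'
  -- Semismoothness at `x + t • e` makes the directional derivative the limit of `V e` over Jacobian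
  -- elements `V` at the points ahead on the ray. The estimate at `x` applies to these same `V` with
  -- increment `(t + s) • e`; then `s ↓ 0`.
  have hVL : Tendsto (fun s : ℝ => Matrix.toEuclideanLin (V (x + t • e + s • e)) e) (𝓝[>] 0)
      (𝓝 L) := by
    have h0 : Tendsto (fun s : ℝ => s⁻¹ • (F (x + t • e + s • e) - F (x + t • e)) -
        Matrix.toEuclideanLin (V (x + t • e + s • e)) e) (𝓝[>] 0) (𝓝 0) := by
      have h1 : Tendsto (fun s : ℝ => s * (C' * ‖e‖ ^ 2)) (𝓝[>] 0) (𝓝 0) := by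
        simpa using hid.mul_const (C' * ‖e‖ ^ 2)
      refine squeeze_zero_norm' ?_ h1
      filter_upwards [hpos, hsmall] with s hs hse
      have h2 := hC' (s • e) hse _ (hV _)
      have h3 : s⁻¹ • (F (x + t • e + s • e) - F (x + t • e)) -
          Matrix.toEuclideanLin (V (x + t • e + s • e)) e =
          s⁻¹ • (F (x + t • e + s • e) - F (x + t • e) -
            Matrix.toEuclideanLin (V (x + t • e + s • e)) (s • e)) := by
        rw [map_smul, smul_sub _ _ (s • _), smul_smul, inv_mul_cancel₀ hs.ne', one_smul]
      rw [h3, norm_smul, Real.norm_of_nonneg (by positivity)]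
      rw [norm_smul, Real.norm_of_nonneg hs.le] at h2
      calc _ ≤ s⁻¹ * (C' * (s * ‖e‖) ^ 2) := by gcongr
        _ = _ := by field_simp
    simpa using hL.sub h0
  have htend : Tendsto (fun s : ℝ => (t + s) • e) (𝓝[>] 0) (𝓝 (t • e)) := by
    simpa using (tendsto_const_nhds.add hid : Tendsto (fun s : ℝ => t + s) _ _).smul_const e
  have hleft : Tendsto (fun s : ℝ => ‖F (x + (t + s) • e) - F x -
      (t + s) • Matrix.toEuclideanLin (V (x + t • e + s • e)) e‖) (𝓝[>] 0)
      (𝓝 ‖F (x + t • e) - F x - t • L‖) := by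
    have h1 : Tendsto (fun s : ℝ => t + s) (𝓝[>] 0) (𝓝 t) := by
      simpa using (tendsto_const_nhds.add hid : Tendsto (fun s : ℝ => t + s) _ _)
    exact ((((hcont.tendsto _).comp (tendsto_const_nhds.add htend)).sub_const (F x)).sub
      (h1.smul hVL)).norm
  refine le_of_tendsto_of_tendsto hleft ((htend.norm.pow 2).const_mul C) ?_
  filter_upwards [htend.norm.eventually_lt_const hte] with s hs
  have h1 := hC ((t + s) • e) hs (V (x + t • e + s • e)) (by
    rw [add_smul, ← add_assoc]; exact hV _)
  rwa [map_smul] at h1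

/-- The half squared distance to `C` has a second-order expansion of trapezoidal type wherever the
projection is strongly semismooth. -/
theorem IsProjection.exists_trapezoid_le {C : Set (EuclideanSpace ℝ ι)}
    {π : EuclideanSpace ℝ ι → EuclideanSpace ℝ ι} (h : IsProjection C π)
    (hss : StronglySemismooth π (clarkeJacobian π)) (x : EuclideanSpace ℝ ι) :
    ∃ K, ∃ ε > 0, ∀ e : EuclideanSpace ℝ ι, ‖e‖ < ε →
      1 / 2 * ⟪(x + e - π (x + e)) - (x - π x), e⟫_ℝ - K * ‖e‖ ^ 3 ≤
        1 / 2 * ‖x + e - π (x + e)‖ ^ 2 - 1 / 2 * ‖x - π x‖ ^ 2 - ⟪x - π x, e⟫_ℝ := by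
  obtain ⟨-, K, ε, hε, hK⟩ := hss.2 x
  refine ⟨1 / 2 * |K|, ε, hε, fun e he => ?_⟩
  choose L hL using fun t : ℝ => (hss.2 (x + t • e)).1 e
  -- `χ` is the error of the trapezoidal rule on `[0, t]`. In its right derivative the linear parts
  -- cancel, leaving the calmness defect `π (x + t • e) - π x - t • L t`, paired with `e`, which is
  -- `O(‖e‖ ^ 3)`.
  set χ : ℝ → ℝ := fun t => 1 / 2 * ‖x + t • e - π (x + t • e)‖ ^ 2 - 1 / 2 * ‖x - π x‖ ^ 2 -
    t * ⟪x - π x, e⟫_ℝ - 1 / 2 * (t * ⟪(x + t • e - π (x + t • e)) - (x - π x), e⟫_ℝ) with hχ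
  have hline : ∀ t : ℝ, HasDerivAt (fun t : ℝ => x + t • e) e t := fun t => by
    simpa using ((hasDerivAt_id t).smul_const e).const_add x
  have hderiv : ∀ t : ℝ, HasDerivWithinAt χ
      (-(1 / 2 * ⟪π (x + t • e) - π x - t • L t, e⟫_ℝ)) (Set.Ici t) t := by
    intro t
    have h1 : HasDerivAt (fun t : ℝ => 1 / 2 * ‖x + t • e - π (x + t • e)‖ ^ 2)
        ⟪x + t • e - π (x + t • e), e⟫_ℝ t := by
      have h3 := (h.bregmanBounds.hasGradientAt le_rfl (x + t • e)).hasFDerivAt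
      exact h3.comp_hasDerivAt t (hline t)
    have h2 : HasDerivWithinAt
        (fun t : ℝ => ⟪(x + t • e - π (x + t • e)) - (x - π x), e⟫_ℝ) ⟪e - L t, e⟫_ℝ
        (Set.Ici t) t := by
      have h3 := (((hline t).hasDerivWithinAt (s := Set.Ici t)).sub
        (hasDerivWithinAt_Ici_of_directional (hL t))).sub_const (x - π x)
      simpa using h3.inner ℝ (hasDerivWithinAt_const t (Set.Ici t) e)
    have h4 := (((h1.hasDerivWithinAt (s := Set.Ici t)).sub_const (1 / 2 * ‖x - π x‖ ^ 2)).sub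
      ((hasDerivWithinAt_id t (Set.Ici t)).mul_const ⟪x - π x, e⟫_ℝ)).sub
      (((hasDerivWithinAt_id t (Set.Ici t)).mul h2).const_mul (1 / 2))
    refine h4.congr_deriv ?_
    simp only [inner_sub_left, inner_add_left, inner_smul_left, conj_trivial, id]
    ring
  have hbound : ∀ t ∈ Set.Ico (0 : ℝ) 1,
      ‖-(1 / 2 * ⟪π (x + t • e) - π x - t • L t, e⟫_ℝ)‖ ≤ 1 / 2 * |K| * ‖e‖ ^ 3 := by
    intro t ht
    have hte : ‖t • e‖ ≤ ‖e‖ := by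
      rw [norm_smul, Real.norm_of_nonneg ht.1]
      exact mul_le_of_le_one_left (norm_nonneg _) ht.2.le
    have h1 := hss.norm_sub_directional_le (clarkeJacobian_nonempty h.lipschitzWith) hK
      (hte.trans_lt he) (hL t)
    have h2 : ‖π (x + t • e) - π x - t • L t‖ ≤ |K| * ‖e‖ ^ 2 :=
      h1.trans (mul_le_mul (le_abs_self K) (pow_le_pow_left₀ (norm_nonneg _) hte 2)
        (by positivity) (abs_nonneg _))
    rw [norm_neg, norm_mul, Real.norm_of_nonneg (by norm_num : (0 : ℝ) ≤ 1 / 2)]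
    calc _ ≤ 1 / 2 * (|K| * ‖e‖ ^ 2 * ‖e‖) := by
          gcongr
          exact (norm_inner_le_norm _ _).trans (by gcongr)
      _ = _ := by ring
  have hmv := norm_image_sub_le_of_norm_deriv_right_le_segment (f := χ) (a := 0) (b := 1)
    ?_ (fun t _ => hderiv t) hbound 1 (by simp)
  · have h0 : χ 0 = 0 := by simp [hχ]
    have h1 := (neg_abs_le _).trans' (neg_le_neg hmv)
    simp only [h0, sub_zero, mul_one] at h1
    simp only [hχ, one_smul, one_mul] at h1
    linarith
  · have hcont : Continuous π := h.lipschitzWith.continuous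
    apply Continuous.continuousOn
    fun_prop

end Clarke

/-! ### The projection onto the nonnegative orthant -/

section Orthant

variable {ι : Type*}

theorem orthant_nonempty : (orthant ι).Nonempty := ⟨0, fun _ => le_rfl⟩

theorem isClosed_orthant : IsClosed (orthant ι) := by
  have : orthant ι = ⋂ i, {η : EuclideanSpace ℝ ι | 0 ≤ η i} := by
    ext η; simp [orthant]
  rw [this]
  exact isClosed_iInter fun i => isClosed_le continuous_const (by fun_prop)

theorem convex_orthant : Convex ℝ (orthant ι) := by
  intro x hx y hy a b ha hb _ i
  have := hx i
  have := hy i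
  simp only [PiLp.add_apply, PiLp.smul_apply, smul_eq_mul]
  positivity

variable [Fintype ι]

theorem inner_eq_sum (x y : EuclideanSpace ℝ ι) : ⟪x, y⟫_ℝ = ∑ i, x i * y i := by
  simp [PiLp.inner_apply, mul_comm]

theorem prox_orthant_apply (η : EuclideanSpace ℝ ι) (i : ι) :
    prox (indicatorFn (orthant ι)) η i = max (η i) 0 := by
  have h := isProjection_prox (orthant_nonempty (ι := ι)) isClosed_orthant convex_orthant
  have h1 : prox (indicatorFn (orthant ι)) η = WithLp.toLp 2 fun i => max (η i) 0 := by
    refine h.eq_of_mem (fun i => le_max_right _ _) fun w hw => ?_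
    rw [inner_eq_sum]
    refine Finset.sum_nonpos fun i _ => ?_
    have hwi := hw i
    simp only [PiLp.sub_apply]
    rcases le_total (η i) 0 with h0 | h0
    · rw [max_eq_right h0]
      nlinarith
    · rw [max_eq_left h0]
      simp
  rw [h1]

/-- Perturbations this small keep the sign of every nonzero coordinate. -/
theorem exists_forall_abs_lt (η : EuclideanSpace ℝ ι) :
    ∃ ε > 0, ∀ h : EuclideanSpace ℝ ι, ‖h‖ < ε → ∀ i, η i ≠ 0 → |h i| < |η i| := by
  have h1 : ∀ᶠ h : EuclideanSpace ℝ ι in 𝓝 0, ∀ i, η i ≠ 0 → |h i| < |η i| := by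
    rw [eventually_all]
    intro i
    by_cases h0 : η i = 0
    · simp [h0]
    · have hc : Tendsto (fun h : EuclideanSpace ℝ ι => |h i|) (𝓝 0) (𝓝 0) := by
        have : Continuous fun h : EuclideanSpace ℝ ι => |h i| := by fun_prop
        simpa using this.tendsto 0
      filter_upwards [hc.eventually_lt_const (abs_pos.mpr h0)] with h hh _
      exact hh
  obtain ⟨ε, hε, h2⟩ := Metric.eventually_nhds_iff.mp h1
  exact ⟨ε, hε, fun h hh => h2 (by simpa using hh)⟩

/-- For small `h`, each coordinate moves from `η i` without crossing the kink at `0`, though it may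
start there. So `η - prox η` is affine along the segment and the trapezoidal rule is exact. -/
theorem exists_prox_orthant_trapezoid (η : EuclideanSpace ℝ ι) :
    ∃ ε > 0, ∀ h : EuclideanSpace ℝ ι, ‖h‖ < ε →
      1 / 2 * ⟪(η + h - prox (indicatorFn (orthant ι)) (η + h)) -
          (η - prox (indicatorFn (orthant ι)) η), h⟫_ℝ =
        1 / 2 * ‖η + h - prox (indicatorFn (orthant ι)) (η + h)‖ ^ 2 -
          1 / 2 * ‖η - prox (indicatorFn (orthant ι)) η‖ ^ 2 -
          ⟪η - prox (indicatorFn (orthant ι)) η, h⟫_ℝ := by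
  obtain ⟨ε, hε, hlt⟩ := exists_forall_abs_lt η
  refine ⟨ε, hε, fun h hh => ?_⟩
  rw [← real_inner_self_eq_norm_sq, ← real_inner_self_eq_norm_sq]
  simp only [inner_eq_sum, Finset.mul_sum, ← Finset.sum_sub_distrib]
  refine Finset.sum_congr rfl fun i _ => ?_
  simp only [PiLp.sub_apply, PiLp.add_apply, prox_orthant_apply]
  have h1 := hlt h hh i
  rcases lt_trichotomy (η i) 0 with h0 | h0 | h0
  · have h2 := h1 h0.ne
    rw [abs_of_neg h0, abs_lt] at h2
    rw [max_eq_right h0.le, max_eq_right (by linarith)]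
    ring
  · rw [h0, zero_add, max_self]
    rcases le_total (h i) 0 with h2 | h2
    · rw [max_eq_right h2]; ring
    · rw [max_eq_left h2]; ring
  · have h2 := h1 h0.ne'
    rw [abs_of_pos h0, abs_lt] at h2
    rw [max_eq_left h0.le, max_eq_left (by linarith)]
    ring

variable [DecidableEq ι]

theorem toEuclideanLin_diagonal_apply (q : ι → ℝ) (v : EuclideanSpace ℝ ι) (i : ι) :
    Matrix.toEuclideanLin (Matrix.diagonal q) v i = q i * v i := by
  simp [Matrix.toLpLin_apply, Matrix.mulVec_diagonal]

/-- The projection onto the orthant is piecewise linear. -/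
theorem exists_prox_orthant_sub_eq (η : EuclideanSpace ℝ ι) :
    ∃ ε > 0, ∀ h : EuclideanSpace ℝ ι, ‖h‖ < ε → ∀ P ∈ jacobianOrthant (η + h),
      prox (indicatorFn (orthant ι)) (η + h) - prox (indicatorFn (orthant ι)) η =
        Matrix.toEuclideanLin P h := by
  obtain ⟨ε, hε, hlt⟩ := exists_forall_abs_lt η
  refine ⟨ε, hε, fun h hh P hP => ?_⟩
  obtain ⟨q, rfl, hq⟩ := hP
  ext i
  rw [toEuclideanLin_diagonal_apply, PiLp.sub_apply, prox_orthant_apply, prox_orthant_apply]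
  obtain ⟨hq1, hq2, hq3⟩ := hq i
  rw [PiLp.add_apply] at *
  have h1 := hlt h hh i
  rcases lt_trichotomy (η i) 0 with h0 | h0 | h0
  · have h2 := h1 h0.ne
    rw [abs_of_neg h0, abs_lt] at h2
    rw [max_eq_right h0.le, max_eq_right (by linarith), hq1 (by linarith)]
    ring
  -- At a kink the sign of `h i` fixes `q i`; when `h i = 0` the free value of `q i` is multiplied
  -- by zero.
  · rw [h0, zero_add] at hq1 hq3 ⊢
    rcases lt_trichotomy (h i) 0 with h2 | h2 | h2
    · rw [hq1 h2, max_eq_right h2.le]; simp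
    · rw [h2]; simp
    · rw [hq3 h2, max_eq_left h2.le]; simp
  · have h2 := h1 h0.ne'
    rw [abs_of_pos h0, abs_lt] at h2
    rw [max_eq_left h0.le, max_eq_left (by linarith), hq3 (by linarith)]
    ring

theorem jacobianOrthant_spec {η : EuclideanSpace ℝ ι} {P : Matrix ι ι ℝ}
    (hP : P ∈ jacobianOrthant η) :
    P.IsHermitian ∧ ∀ v, ⟪Matrix.toEuclideanLin P v, v⟫_ℝ ≤ ‖v‖ ^ 2 ∧
      ‖Matrix.toEuclideanLin P v‖ ≤ ‖v‖ := by
  obtain ⟨q, rfl, hq⟩ := hP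
  have hq' : ∀ i, 0 ≤ q i ∧ q i ≤ 1 := by
    intro i
    obtain ⟨h1, h2, h3⟩ := hq i
    rcases lt_trichotomy (η i) 0 with h0 | h0 | h0
    · rw [h1 h0]; norm_num
    · exact h2 h0
    · rw [h3 h0]; norm_num
  have hn : ∀ v : EuclideanSpace ℝ ι, ‖Matrix.toEuclideanLin (Matrix.diagonal q) v‖ ≤ ‖v‖ := by
    intro v
    rw [← sq_le_sq₀ (norm_nonneg _) (norm_nonneg _), EuclideanSpace.norm_sq_eq,
      EuclideanSpace.norm_sq_eq]
    refine Finset.sum_le_sum fun i _ => ?_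
    rw [toEuclideanLin_diagonal_apply, norm_mul, mul_pow]
    refine mul_le_of_le_one_left (by positivity) ?_
    rw [Real.norm_of_nonneg (hq' i).1]
    exact pow_le_one₀ (hq' i).1 (hq' i).2
  refine ⟨Matrix.isHermitian_diagonal q, fun v => ⟨?_, hn v⟩⟩
  rw [sq]
  exact (real_inner_le_norm _ _).trans (mul_le_mul_of_nonneg_right (hn v) (norm_nonneg _))

end Orthant

/-! ### Bounds for matrices and linear maps -/

section Bounds

theorem exists_forall_norm_le {E F : Type*} [NormedAddCommGroup E] [NormedSpace ℝ E]
    [NormedAddCommGroup F] [NormedSpace ℝ F] [FiniteDimensional ℝ E] (f : E →ₗ[ℝ] F) :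
    ∃ K, 0 ≤ K ∧ ∀ v, ‖f v‖ ≤ K * ‖v‖ :=
  ⟨‖LinearMap.toContinuousLinearMap f‖, norm_nonneg _,
    fun v => (LinearMap.toContinuousLinearMap f).le_opNorm v⟩

theorem norm_le_of_forall_inner_le {E : Type*} [NormedAddCommGroup E] [InnerProductSpace ℝ E]
    {v : E} {K : ℝ} (hK : 0 ≤ K) (h : ∀ w, ⟪v, w⟫_ℝ ≤ K * ‖w‖) : ‖v‖ ≤ K := by
  rcases (norm_nonneg v).eq_or_lt with h0 | h0
  · rw [← h0]; exact hK
  · have h1 := h v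
    rw [real_inner_self_eq_norm_mul_norm] at h1
    exact le_of_mul_le_mul_right h1 h0

/-- Positivity on the compact unit sphere, extended by homogeneity. -/
theorem exists_forall_le_normSqH {ι : Type*} [Fintype ι] [DecidableEq ι] {H : Matrix ι ι ℝ}
    (hH : H.PosDef) : ∃ c > 0, ∀ v, c * ‖v‖ ^ 2 ≤ normSqH H v := by
  have hcont : Continuous (normSqH H) := by
    have : Continuous (Matrix.toEuclideanLin H) := LinearMap.continuous_of_finiteDimensional _
    unfold normSqH
    fun_prop
  obtain ⟨c, hc, hle⟩ := (isCompact_sphere (0 : EuclideanSpace ℝ ι) 1).exists_forall_le'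
    hcont.continuousOn (a := 0) (fun v hv =>
      inner_toEuclideanLin_self_pos hH (ne_zero_of_mem_unit_sphere ⟨v, hv⟩))
  refine ⟨c, hc, fun v => ?_⟩
  by_cases hv : v = 0
  · simp [hv, normSqH]
  · have hn : 0 < ‖v‖ := norm_pos_iff.mpr hv
    have h1 := hle (‖v‖⁻¹ • v) (by simp [norm_smul, hn.ne'])
    unfold normSqH at *
    rw [map_smul, inner_smul_left, inner_smul_right, conj_trivial] at h1
    calc c * ‖v‖ ^ 2 ≤ ‖v‖⁻¹ * (‖v‖⁻¹ * ⟪v, Matrix.toEuclideanLin H v⟫_ℝ) * ‖v‖ ^ 2 := by gcongr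
      _ = _ := by field_simp

end Bounds

/-! ### The gradient and the generalized Hessian of the subproblem -/

section Subproblem

variable {n d : ℕ}

/-- `thetaPart` as a linear map. -/
def thetaMap (n d : ℕ) : Var n d →ₗ[ℝ] EuclideanSpace ℝ (Fin n) where
  toFun := thetaPart
  map_add' _ _ := rfl
  map_smul' _ _ := rfl

/-- `xiPart` as a linear map. -/
def xiMap (n d : ℕ) : Var n d →ₗ[ℝ] EuclideanSpace ℝ (Fin n × Fin d) where
  toFun := xiPart
  map_add' _ _ := rfl
  map_smul' _ _ := rfl

theorem inner_eq_parts (v w : Var n d) :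
    ⟪v, w⟫_ℝ = ⟪thetaMap n d v, thetaMap n d w⟫_ℝ + ⟪xiMap n d v, xiMap n d w⟫_ℝ := by
  rw [inner_eq_sum, inner_eq_sum, inner_eq_sum, Fintype.sum_sum_type]
  rfl

theorem norm_sq_eq_parts (v : Var n d) :
    ‖v‖ ^ 2 = ‖thetaMap n d v‖ ^ 2 + ‖xiMap n d v‖ ^ 2 := by
  simp only [← real_inner_self_eq_norm_sq]
  exact inner_eq_parts v v

theorem norm_thetaMap_le (v : Var n d) : ‖thetaMap n d v‖ ≤ ‖v‖ := by
  rw [← sq_le_sq₀ (norm_nonneg _) (norm_nonneg _), norm_sq_eq_parts v]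
  exact le_add_of_nonneg_right (by positivity)

theorem norm_xiMap_le (v : Var n d) : ‖xiMap n d v‖ ≤ ‖v‖ := by
  rw [← sq_le_sq₀ (norm_nonneg _) (norm_nonneg _), norm_sq_eq_parts v]
  exact le_add_of_nonneg_left (by positivity)

theorem inner_fromBlocks_diagonal (A : Matrix (Fin n) (Fin n) ℝ)
    (D : Matrix (Fin n × Fin d) (Fin n × Fin d) ℝ) (v w : Var n d) :
    ⟪Matrix.toEuclideanLin (Matrix.fromBlocks A 0 0 D) v, w⟫_ℝ =
      ⟪Matrix.toEuclideanLin A (thetaMap n d v), thetaMap n d w⟫_ℝ +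
        ⟪Matrix.toEuclideanLin D (xiMap n d v), xiMap n d w⟫_ℝ := by
  have h1 : thetaMap n d (Matrix.toEuclideanLin (Matrix.fromBlocks A 0 0 D) v) =
      Matrix.toEuclideanLin A (thetaMap n d v) := by
    ext i
    change (Matrix.fromBlocks A 0 0 D).mulVec v.ofLp (Sum.inl i) = _
    rw [Matrix.fromBlocks_mulVec]
    simp only [Sum.elim_inl, Matrix.zero_mulVec, add_zero]
    rfl
  have h2 : xiMap n d (Matrix.toEuclideanLin (Matrix.fromBlocks A 0 0 D) v) =
      Matrix.toEuclideanLin D (xiMap n d v) := by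
    ext i
    change (Matrix.fromBlocks A 0 0 D).mulVec v.ofLp (Sum.inr i) = _
    rw [Matrix.fromBlocks_mulVec]
    simp only [Sum.elim_inr, Matrix.zero_mulVec, zero_add]
    rfl
  rw [inner_eq_parts, h1, h2]

/-- The set of all `ξ` whose blocks lie in `D`. -/
def blockSet (n : ℕ) (D : Set (EuclideanSpace ℝ (Fin d))) :
    Set (EuclideanSpace ℝ (Fin n × Fin d)) :=
  {ξ | ∀ i, block ξ i ∈ D}

/-- This makes `Prox_p` a metric projection, so that the results on projections apply to it. -/
theorem penalty_eq_indicatorFn (D : Set (EuclideanSpace ℝ (Fin d))) :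
    penalty n D = indicatorFn (blockSet n D) := by
  classical
  funext ξ
  by_cases h : ξ ∈ blockSet n D
  · have h1 : ∀ i, indicatorFn D (block ξ i) = 0 := fun i => by simp [indicatorFn, h i]
    rw [penalty, Finset.sum_congr rfl fun i _ => h1 i]
    simp [indicatorFn, h]
  · have h' : ∃ i, block ξ i ∉ D := by simpa [blockSet] using h
    obtain ⟨i, hi⟩ := h'
    have h0 : ∀ j ∈ Finset.univ, 0 ≤ indicatorFn D (block ξ j) := fun j _ => by
      unfold indicatorFn; split_ifs <;> simp
    have h1 := Finset.single_le_sum h0 (Finset.mem_univ i)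
    have h2 : indicatorFn D (block ξ i) = ⊤ := by simp [indicatorFn, hi]
    rw [h2, top_le_iff] at h1
    rw [penalty, h1]
    simp [indicatorFn, h]

theorem blockSet_nonempty {D : Set (EuclideanSpace ℝ (Fin d))} (hD : D.Nonempty) :
    (blockSet n D).Nonempty := by
  obtain ⟨x, hx⟩ := hD
  exact ⟨WithLp.toLp 2 fun q => x q.2, fun _ => hx⟩

theorem isClosed_blockSet {D : Set (EuclideanSpace ℝ (Fin d))} (hD : IsClosed D) :
    IsClosed (blockSet n D) := by
  have h : blockSet n D = ⋂ i, (fun ξ => block ξ i) ⁻¹' D := by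
    ext ξ; simp [blockSet]
  rw [h]
  refine isClosed_iInter fun i => hD.preimage ?_
  unfold block
  fun_prop

theorem convex_blockSet {D : Set (EuclideanSpace ℝ (Fin d))} (hD : Convex ℝ D) :
    Convex ℝ (blockSet n D) :=
  fun _ hx _ hy _ _ ha hb hab i => hD (hx i) (hy i) ha hb hab

namespace Subproblem

variable (S : Subproblem n d)

/-- The linear map with matrix `(A B)`. -/
noncomputable def constraintMap : Var n d →ₗ[ℝ] EuclideanSpace ℝ (Fin n × Fin n) :=
  Matrix.toEuclideanLin (Matrix.fromCols (matA n) (matB S.X))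

theorem slack_eq (z : Var n d) :
    S.slack (thetaPart z) (xiPart z) S.ut = S.constraintMap z - S.σ⁻¹ • S.ut := by
  have h : Matrix.toEuclideanLin (matA n) (thetaPart z) +
      Matrix.toEuclideanLin (matB S.X) (xiPart z) = S.constraintMap z := by
    ext i
    change _ = (Matrix.fromCols (matA n) (matB S.X)).mulVec z.ofLp i
    rw [Matrix.fromCols_mulVec]
    rfl
  rw [slack, h]

/-- The gradient of `S.Phi`. -/
noncomputable def gradPhi (z : Var n d) : Var n d :=
  (thetaMap n d).adjoint (thetaMap n d z - S.Y +
      S.σ⁻¹ • Matrix.toEuclideanLin S.H₁ (thetaMap n d z - S.θt)) +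
    (xiMap n d).adjoint (S.σ • (xiMap n d z - S.σ⁻¹ • S.vt - prox S.p (xiMap n d z - S.σ⁻¹ • S.vt)) +
      S.σ⁻¹ • Matrix.toEuclideanLin S.H₂ (xiMap n d z - S.ξt)) +
    S.constraintMap.adjoint (S.σ • (S.constraintMap z - S.σ⁻¹ • S.ut -
      prox (indicatorFn (orthant (Fin n × Fin n))) (S.constraintMap z - S.σ⁻¹ • S.ut)))

/-- The weak form removes the adjoints and has the same five summands as `inner_genHessian`, so
gradient differences and Hessians can be compared term by term. -/
theorem inner_gradPhi (z w : Var n d) : ⟪S.gradPhi z, w⟫_ℝ =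
    ⟪thetaMap n d z - S.Y, thetaMap n d w⟫_ℝ +
    S.σ⁻¹ * ⟪Matrix.toEuclideanLin S.H₁ (thetaMap n d z - S.θt), thetaMap n d w⟫_ℝ +
    S.σ * ⟪xiMap n d z - S.σ⁻¹ • S.vt - prox S.p (xiMap n d z - S.σ⁻¹ • S.vt), xiMap n d w⟫_ℝ +
    S.σ⁻¹ * ⟪Matrix.toEuclideanLin S.H₂ (xiMap n d z - S.ξt), xiMap n d w⟫_ℝ +
    S.σ * ⟪S.constraintMap z - S.σ⁻¹ • S.ut -
      prox (indicatorFn (orthant (Fin n × Fin n))) (S.constraintMap z - S.σ⁻¹ • S.ut),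
      S.constraintMap w⟫_ℝ := by
  rw [gradPhi, inner_add_left, inner_add_left, LinearMap.adjoint_inner_left,
    LinearMap.adjoint_inner_left, LinearMap.adjoint_inner_left]
  simp only [inner_add_left, inner_smul_left, conj_trivial]
  ring

theorem inner_genHessian {H : Matrix (Fin n ⊕ Fin n × Fin d) (Fin n ⊕ Fin n × Fin d) ℝ}
    {P : Matrix (Fin n × Fin n) (Fin n × Fin n) ℝ} {Q : Matrix (Fin n × Fin d) (Fin n × Fin d) ℝ}
    (hH : H = S.σ • ((Matrix.fromCols (matA n) (matB S.X)).transpose * (1 - P)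
        * Matrix.fromCols (matA n) (matB S.X))
      + Matrix.fromBlocks (1 + S.σ⁻¹ • S.H₁) 0 0 (S.σ • (1 - Q) + S.σ⁻¹ • S.H₂)) (v w : Var n d) :
    ⟪Matrix.toEuclideanLin H v, w⟫_ℝ =
    ⟪thetaMap n d v, thetaMap n d w⟫_ℝ +
    S.σ⁻¹ * ⟪Matrix.toEuclideanLin S.H₁ (thetaMap n d v), thetaMap n d w⟫_ℝ +
    S.σ * ⟪xiMap n d v - Matrix.toEuclideanLin Q (xiMap n d v), xiMap n d w⟫_ℝ +
    S.σ⁻¹ * ⟪Matrix.toEuclideanLin S.H₂ (xiMap n d v), xiMap n d w⟫_ℝ +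
    S.σ * ⟪S.constraintMap v - Matrix.toEuclideanLin P (S.constraintMap v),
      S.constraintMap w⟫_ℝ := by
  have hone : ∀ {κ : Type} [Fintype κ] [DecidableEq κ] (u : EuclideanSpace ℝ κ),
      Matrix.toEuclideanLin (1 : Matrix κ κ ℝ) u = u := by
    intro κ _ _ u
    simp
  have h1 : ⟪Matrix.toEuclideanLin ((Matrix.fromCols (matA n) (matB S.X)).transpose * (1 - P)
      * Matrix.fromCols (matA n) (matB S.X)) v, w⟫_ℝ =
      ⟪S.constraintMap v - Matrix.toEuclideanLin P (S.constraintMap v), S.constraintMap w⟫_ℝ := by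
    have h2 : Matrix.toEuclideanLin ((Matrix.fromCols (matA n) (matB S.X)).transpose * (1 - P)
        * Matrix.fromCols (matA n) (matB S.X)) v =
        S.constraintMap.adjoint (Matrix.toEuclideanLin (1 - P) (S.constraintMap v)) := by
      rw [constraintMap, ← Matrix.toEuclideanLin_conjTranspose_eq_adjoint,
        Matrix.conjTranspose_eq_transpose_of_trivial]
      simp only [Matrix.toLpLin_apply, Matrix.mulVec_mulVec, Matrix.mul_assoc]
    rw [h2, LinearMap.adjoint_inner_left, map_sub, LinearMap.sub_apply, hone]
  rw [hH, map_add, LinearMap.add_apply, inner_add_left, map_smul, LinearMap.smul_apply,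
    inner_smul_left, h1, inner_fromBlocks_diagonal]
  simp only [map_add, map_smul, map_sub, LinearMap.add_apply, LinearMap.smul_apply,
    LinearMap.sub_apply, hone, inner_add_left, inner_smul_left, conj_trivial]
  ring

end Subproblem

end Subproblem

/-! ### Strong convexity, semismoothness and the trapezoidal bound for `Φ` -/

section Assembly

variable {n d : ℕ}

theorem half_norm_sq_add_sub {E : Type*} [NormedAddCommGroup E] [InnerProductSpace ℝ E]
    (a h : E) : 1 / 2 * ‖a + h‖ ^ 2 - 1 / 2 * ‖a‖ ^ 2 - ⟪a, h⟫_ℝ = 1 / 2 * ‖h‖ ^ 2 := by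
  rw [norm_add_sq_real]
  ring

theorem normSqH_add_sub {ι : Type*} [Fintype ι] [DecidableEq ι] {H : Matrix ι ι ℝ}
    (hH : H.IsHermitian) (a h : EuclideanSpace ℝ ι) :
    normSqH H (a + h) - normSqH H a - 2 * ⟪Matrix.toEuclideanLin H a, h⟫_ℝ = normSqH H h := by
  unfold normSqH
  rw [map_add, inner_add_left, inner_add_right, inner_add_right,
    real_inner_comm (Matrix.toEuclideanLin H a) h, inner_toEuclideanLin_comm hH]
  ring

theorem normSqH_le {ι : Type*} [Fintype ι] [DecidableEq ι] {H : Matrix ι ι ℝ} {K : ℝ}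
    (hK : ∀ v, ‖Matrix.toEuclideanLin H v‖ ≤ K * ‖v‖) (v : EuclideanSpace ℝ ι) :
    normSqH H v ≤ K * ‖v‖ ^ 2 := by
  unfold normSqH
  have h1 := (real_inner_le_norm v (Matrix.toEuclideanLin H v)).trans
    (mul_le_mul_of_nonneg_left (hK v) (norm_nonneg v))
  linarith

theorem isProjection_prox_orthant {ι : Type*} [Fintype ι] :
    IsProjection (orthant ι) (prox (indicatorFn (orthant ι))) :=
  isProjection_prox orthant_nonempty isClosed_orthant convex_orthant

namespace Subproblem

variable {S : Subproblem n d}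

theorem isProjection_prox_p (hne : S.D.Nonempty) (hcl : IsClosed S.D) (hcv : Convex ℝ S.D) :
    IsProjection (blockSet n S.D) (prox S.p) := by
  rw [p, penalty_eq_indicatorFn]
  exact isProjection_prox (blockSet_nonempty hne) (isClosed_blockSet hcl) (convex_blockSet hcv)

theorem Phi_eq (hne : S.D.Nonempty) (hcl : IsClosed S.D) (hcv : Convex ℝ S.D) (z : Var n d) :
    S.Phi z = 1 / 2 * ‖thetaMap n d z - S.Y‖ ^ 2
      + S.σ * (1 / 2 * ‖xiMap n d z - S.σ⁻¹ • S.vt - prox S.p (xiMap n d z - S.σ⁻¹ • S.vt)‖ ^ 2)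
      + S.σ * (1 / 2 * ‖S.constraintMap z - S.σ⁻¹ • S.ut -
        prox (indicatorFn (orthant (Fin n × Fin n))) (S.constraintMap z - S.σ⁻¹ • S.ut)‖ ^ 2)
      - 1 / (2 * S.σ) * ‖S.ut‖ ^ 2 - 1 / (2 * S.σ) * ‖S.vt‖ ^ 2
      + 1 / (2 * S.σ) * normSqH S.H₁ (thetaMap n d z - S.θt)
      + 1 / (2 * S.σ) * normSqH S.H₂ (xiMap n d z - S.ξt) := by
  have h1 : moreauEnvelope S.p (xiMap n d z - S.σ⁻¹ • S.vt) =
      1 / 2 * ‖xiMap n d z - S.σ⁻¹ • S.vt - prox S.p (xiMap n d z - S.σ⁻¹ • S.vt)‖ ^ 2 := by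
    rw [p, penalty_eq_indicatorFn]
    exact moreauEnvelope_indicatorFn (blockSet_nonempty hne) (isClosed_blockSet hcl)
      (convex_blockSet hcv) _
  rw [Phi, augLagrangian, slack_eq,
    moreauEnvelope_indicatorFn orthant_nonempty isClosed_orthant convex_orthant, ← h1]
  rfl

/-- The Bregman distance of `S.Phi` splits into those of its summands. -/
theorem Phi_bregman (hne : S.D.Nonempty) (hcl : IsClosed S.D) (hcv : Convex ℝ S.D)
    (hσ : 0 < S.σ) (hH₁ : S.H₁.IsHermitian) (hH₂ : S.H₂.IsHermitian) (z h : Var n d)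
    {x : EuclideanSpace ℝ (Fin n × Fin d)} {η : EuclideanSpace ℝ (Fin n × Fin n)}
    (hx : x = xiMap n d z - S.σ⁻¹ • S.vt) (hη : η = S.constraintMap z - S.σ⁻¹ • S.ut) :
    S.Phi (z + h) - S.Phi z - ⟪S.gradPhi z, h⟫_ℝ =
      1 / 2 * ‖thetaMap n d h‖ ^ 2 + 1 / 2 * (S.σ⁻¹ * normSqH S.H₁ (thetaMap n d h)) +
      1 / 2 * (S.σ⁻¹ * normSqH S.H₂ (xiMap n d h)) +
      S.σ * (1 / 2 * ‖x + xiMap n d h - prox S.p (x + xiMap n d h)‖ ^ 2 -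
        1 / 2 * ‖x - prox S.p x‖ ^ 2 - ⟪x - prox S.p x, xiMap n d h⟫_ℝ) +
      S.σ * (1 / 2 * ‖η + S.constraintMap h -
          prox (indicatorFn (orthant (Fin n × Fin n))) (η + S.constraintMap h)‖ ^ 2 -
        1 / 2 * ‖η - prox (indicatorFn (orthant (Fin n × Fin n))) η‖ ^ 2 -
        ⟪η - prox (indicatorFn (orthant (Fin n × Fin n))) η, S.constraintMap h⟫_ℝ) := by
  rw [Phi_eq hne hcl hcv, Phi_eq hne hcl hcv, inner_gradPhi]
  simp only [map_add, add_sub_right_comm, ← hx, ← hη]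
  have h1 := half_norm_sq_add_sub (thetaMap n d z - S.Y) (thetaMap n d h)
  have h2 := normSqH_add_sub hH₁ (thetaMap n d z - S.θt) (thetaMap n d h)
  have h3 := normSqH_add_sub hH₂ (xiMap n d z - S.ξt) (xiMap n d h)
  rw [← h1, ← h2, ← h3]
  field_simp
  ring

/-- The operators in the generalized Hessian. -/
def hessianOps (S : Subproblem n d) (z : Var n d) : Set (Var n d →ₗ[ℝ] Var n d) :=
  (fun H => Matrix.toEuclideanLin H) '' S.genHessian z

theorem exists_bounds (hne : S.D.Nonempty) (hcl : IsClosed S.D) (hcv : Convex ℝ S.D)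
    (hσ : 0 < S.σ) (hH₁ : S.H₁.PosDef) (hH₂ : S.H₂.PosDef) :
    ∃ c > 0, ∃ L > 0, BregmanBounds c L S.Phi S.gradPhi ∧
      ∀ z, ∀ T ∈ S.hessianOps z, ∀ v, c * ‖v‖ ^ 2 ≤ ⟪T v, v⟫_ℝ ∧ ‖T v‖ ≤ L * ‖v‖ := by
  obtain ⟨c₂, hc₂, hlow₂⟩ := exists_forall_le_normSqH hH₂
  obtain ⟨k₁, hk₁, hup₁⟩ := exists_forall_norm_le (Matrix.toEuclideanLin S.H₁)
  obtain ⟨k₂, hk₂, hup₂⟩ := exists_forall_norm_le (Matrix.toEuclideanLin S.H₂)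
  obtain ⟨g, hg, hG⟩ := exists_forall_norm_le S.constraintMap
  have hi : 0 < S.σ⁻¹ := inv_pos.mpr hσ
  have hnn₁ : ∀ v, 0 ≤ normSqH S.H₁ v := fun v => by
    obtain ⟨c₁, hc₁, hlow₁⟩ := exists_forall_le_normSqH hH₁
    exact le_trans (by positivity) (hlow₁ v)
  have hlow : ∀ v : Var n d, min 1 (S.σ⁻¹ * c₂) * ‖v‖ ^ 2 ≤
      ‖thetaMap n d v‖ ^ 2 + S.σ⁻¹ * normSqH S.H₂ (xiMap n d v) := by
    intro v
    rw [norm_sq_eq_parts v, mul_add]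
    refine add_le_add ?_ ?_
    · exact mul_le_of_le_one_left (by positivity) (min_le_left _ _)
    · calc _ ≤ S.σ⁻¹ * c₂ * ‖xiMap n d v‖ ^ 2 :=
            mul_le_mul_of_nonneg_right (min_le_right _ _) (by positivity)
        _ ≤ _ := by rw [mul_assoc]; exact mul_le_mul_of_nonneg_left (hlow₂ _) hi.le
  -- The lower constant takes `1` from the least-squares term and `c₂ / σ` from `H₂`. The factors
  -- `2` in the upper one come from `‖v - Q v‖ ≤ 2 * ‖v‖` and likewise for `P`; the same constant
  -- serves the Bregman bound with room to spare.
  refine ⟨min 1 (S.σ⁻¹ * c₂), lt_min one_pos (by positivity),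
    1 + S.σ⁻¹ * k₁ + S.σ⁻¹ * k₂ + S.σ * 2 + S.σ * (2 * g * g), by positivity, ?_, ?_⟩
  · intro z y
    obtain ⟨h, rfl⟩ : ∃ h, y = z + h := ⟨y - z, by abel⟩
    rw [add_sub_cancel_left]
    rw [Phi_bregman hne hcl hcv hσ hH₁.isHermitian hH₂.isHermitian z h rfl rfl]
    set x := xiMap n d z - S.σ⁻¹ • S.vt
    set η := S.constraintMap z - S.σ⁻¹ • S.ut
    have b1 := (isProjection_prox_p hne hcl hcv).bregmanBounds x (x + xiMap n d h)
    have b2 := isProjection_prox_orthant.bregmanBounds η (η + S.constraintMap h)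
    rw [add_sub_cancel_left, zero_div, zero_mul] at b1 b2
    have hθ := pow_le_pow_left₀ (norm_nonneg _) (norm_thetaMap_le h) 2
    have hξ := pow_le_pow_left₀ (norm_nonneg _) (norm_xiMap_le h) 2
    constructor
    · have h1 := mul_nonneg hσ.le b1.1
      have h2 := mul_nonneg hσ.le b2.1
      have h3 := mul_nonneg hi.le (hnn₁ (thetaMap n d h))
      have h4 := hlow h
      linarith
    · have h1 := mul_le_mul_of_nonneg_left b1.2 hσ.le
      have h2 := mul_le_mul_of_nonneg_left b2.2 hσ.le
      have h3 : S.σ⁻¹ * normSqH S.H₁ (thetaMap n d h) ≤ S.σ⁻¹ * k₁ * ‖h‖ ^ 2 := by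
        rw [mul_assoc]
        exact mul_le_mul_of_nonneg_left ((normSqH_le hup₁ _).trans (by gcongr)) hi.le
      have h4 : S.σ⁻¹ * normSqH S.H₂ (xiMap n d h) ≤ S.σ⁻¹ * k₂ * ‖h‖ ^ 2 := by
        rw [mul_assoc]
        exact mul_le_mul_of_nonneg_left ((normSqH_le hup₂ _).trans (by gcongr)) hi.le
      have h5 : S.σ * ‖S.constraintMap h‖ ^ 2 ≤ S.σ * (g * g) * ‖h‖ ^ 2 := by
        rw [mul_assoc]
        refine mul_le_mul_of_nonneg_left ?_ hσ.le
        calc _ ≤ (g * ‖h‖) ^ 2 := pow_le_pow_left₀ (norm_nonneg _) (hG h) 2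
          _ = _ := by ring
      have h6 : S.σ * ‖xiMap n d h‖ ^ 2 ≤ S.σ * ‖h‖ ^ 2 := mul_le_mul_of_nonneg_left hξ hσ.le
      have h7 : 0 ≤ S.σ * (g * g) * ‖h‖ ^ 2 := by positivity
      have h8 : 0 ≤ S.σ * ‖h‖ ^ 2 := by positivity
      linarith
  · rintro z _ ⟨H, ⟨P, hP, Q, hQ, hH⟩, rfl⟩ v
    have hQs := ((isProjection_prox_p hne hcl hcv).clarkeJacobian_spec hQ).2
    have hPs := (jacobianOrthant_spec hP).2
    constructor
    · dsimp only
      rw [S.inner_genHessian hH, real_inner_self_eq_norm_sq,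
        real_inner_comm _ (Matrix.toEuclideanLin S.H₁ _),
        real_inner_comm _ (Matrix.toEuclideanLin S.H₂ _), inner_sub_left, inner_sub_left,
        real_inner_self_eq_norm_sq, real_inner_self_eq_norm_sq]
      have h1 := mul_nonneg hi.le (hnn₁ (thetaMap n d v))
      have h2 : 0 ≤ S.σ * (‖xiMap n d v‖ ^ 2 -
          ⟪Matrix.toEuclideanLin Q (xiMap n d v), xiMap n d v⟫_ℝ) := by
        refine mul_nonneg hσ.le (sub_nonneg.mpr ?_)
        rw [sq]
        exact (real_inner_le_norm _ _).trans
          (mul_le_mul_of_nonneg_right (hQs _).2 (norm_nonneg _))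
      have h3 : 0 ≤ S.σ * (‖S.constraintMap v‖ ^ 2 -
          ⟪Matrix.toEuclideanLin P (S.constraintMap v), S.constraintMap v⟫_ℝ) :=
        mul_nonneg hσ.le (sub_nonneg.mpr (hPs _).1)
      have h4 := hlow v
      unfold normSqH at h1 h4
      linarith
    · refine norm_le_of_forall_inner_le (by positivity) fun w => ?_
      dsimp only
      rw [S.inner_genHessian hH]
      have hvθ := norm_thetaMap_le v
      have hwθ := norm_thetaMap_le w
      have hvξ := norm_xiMap_le v
      have hwξ := norm_xiMap_le w
      have h1 : ⟪thetaMap n d v, thetaMap n d w⟫_ℝ ≤ ‖v‖ * ‖w‖ :=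
        (real_inner_le_norm _ _).trans (by gcongr)
      have h2 : ⟪Matrix.toEuclideanLin S.H₁ (thetaMap n d v), thetaMap n d w⟫_ℝ ≤
          k₁ * ‖v‖ * ‖w‖ := by
        refine (real_inner_le_norm _ _).trans (mul_le_mul ((hup₁ _).trans ?_) hwθ
          (norm_nonneg _) (by positivity))
        gcongr
      have h3 : ⟪Matrix.toEuclideanLin S.H₂ (xiMap n d v), xiMap n d w⟫_ℝ ≤
          k₂ * ‖v‖ * ‖w‖ := by
        refine (real_inner_le_norm _ _).trans (mul_le_mul ((hup₂ _).trans ?_) hwξ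
          (norm_nonneg _) (by positivity))
        gcongr
      have h4 : ⟪xiMap n d v - Matrix.toEuclideanLin Q (xiMap n d v), xiMap n d w⟫_ℝ ≤
          2 * ‖v‖ * ‖w‖ := by
        refine (real_inner_le_norm _ _).trans (mul_le_mul ((norm_sub_le _ _).trans ?_) hwξ
          (norm_nonneg _) (by positivity))
        linarith [(hQs (xiMap n d v)).2]
      have h5 : ⟪S.constraintMap v - Matrix.toEuclideanLin P (S.constraintMap v),
          S.constraintMap w⟫_ℝ ≤ 2 * (g * ‖v‖) * (g * ‖w‖) := by
        refine (real_inner_le_norm _ _).trans (mul_le_mul ((norm_sub_le _ _).trans ?_) (hG w)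
          (norm_nonneg _) (by positivity))
        linarith [(hPs (S.constraintMap v)).2, hG v]
      have h2' := mul_le_mul_of_nonneg_left h2 hi.le
      have h3' := mul_le_mul_of_nonneg_left h3 hi.le
      have h4' := mul_le_mul_of_nonneg_left h4 hσ.le
      have h5' := mul_le_mul_of_nonneg_left h5 hσ.le
      linarith

/-- The orthogonality relations of PCG need a symmetric matrix; the delicate block is `Q`, whose
symmetry comes from `clarkeJacobian_spec`. -/
theorem isHermitian_of_mem_genHessian (hne : S.D.Nonempty) (hcl : IsClosed S.D)
    (hcv : Convex ℝ S.D) (hH₁ : S.H₁.IsHermitian) (hH₂ : S.H₂.IsHermitian) {z : Var n d}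
    {H : Matrix (Fin n ⊕ Fin n × Fin d) (Fin n ⊕ Fin n × Fin d) ℝ} (hH : H ∈ S.genHessian z) :
    H.IsHermitian := by
  obtain ⟨P, hP, Q, hQ, hH⟩ := hH
  have hQs := ((isProjection_prox_p hne hcl hcv).clarkeJacobian_spec hQ).1
  have hPs := (jacobianOrthant_spec hP).1
  refine Matrix.isSymmetric_toEuclideanLin_iff.mp fun v w => ?_
  rw [real_inner_comm (Matrix.toEuclideanLin H w) v, S.inner_genHessian hH, S.inner_genHessian hH]
  simp only [inner_sub_left]
  rw [inner_toEuclideanLin_comm hH₁ (thetaMap n d v), inner_toEuclideanLin_comm hH₂ (xiMap n d v),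
    inner_toEuclideanLin_comm hQs (xiMap n d v), inner_toEuclideanLin_comm hPs (S.constraintMap v),
    real_inner_comm _ (thetaMap n d v), real_inner_comm _ (thetaMap n d v),
    real_inner_comm (xiMap n d w), real_inner_comm _ (xiMap n d v), real_inner_comm _ (xiMap n d v),
    real_inner_comm (S.constraintMap w), real_inner_comm _ (S.constraintMap v)]

/-- The quadratic terms cancel exactly, and so does the orthant term by piecewise linearity. Only
the remainder of `Prox_p` survives, scaled by `σ`. -/
theorem exists_semismooth (hprox : StronglySemismooth (prox S.p) (clarkeJacobian (prox S.p)))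
    (hσ : 0 < S.σ) (z : Var n d) : ∃ C, ∃ ε > 0, ∀ h, ‖h‖ < ε → ∀ T ∈ S.hessianOps (z + h),
      ‖S.gradPhi (z + h) - S.gradPhi z - T h‖ ≤ C * ‖h‖ ^ 2 := by
  obtain ⟨g, hg, hG⟩ := exists_forall_norm_le S.constraintMap
  obtain ⟨-, C, ε₁, hε₁, hC⟩ := hprox.2 (xiMap n d z - S.σ⁻¹ • S.vt)
  obtain ⟨ε₂, hε₂, hP'⟩ := exists_prox_orthant_sub_eq (S.constraintMap z - S.σ⁻¹ • S.ut)
  -- The `+ 1` keeps the radius meaningful when `g = 0`; `‖S.constraintMap h‖ ≤ g * ‖h‖` then stays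
  -- below `ε₂`.
  refine ⟨S.σ * |C|, min ε₁ (ε₂ / (g + 1)), lt_min hε₁ (by positivity), ?_⟩
  rintro h hh _ ⟨H, ⟨P, hP, Q, hQ, hH⟩, rfl⟩
  have hξ := norm_xiMap_le h
  have hh₁ : ‖xiMap n d h‖ < ε₁ := hξ.trans_lt (hh.trans_le (min_le_left _ _))
  have hh₂ : ‖S.constraintMap h‖ < ε₂ := by
    have h1 := hh.trans_le (min_le_right _ _)
    rw [lt_div_iff₀ (by positivity)] at h1
    nlinarith [hG h, norm_nonneg h]
  rw [slack_eq, map_add, add_sub_right_comm] at hP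
  have hQ1 : Q ∈ clarkeJacobian (prox S.p) (xiMap n d z - S.σ⁻¹ • S.vt + xiMap n d h) := by
    rw [← add_sub_right_comm, ← map_add]
    exact hQ
  have e1 := hC _ hh₁ Q hQ1
  have e2 := hP' _ hh₂ P hP
  refine norm_le_of_forall_inner_le (by positivity) fun w => ?_
  have key : ⟪S.gradPhi (z + h) - S.gradPhi z - Matrix.toEuclideanLin H h, w⟫_ℝ =
      -(S.σ * ⟪prox S.p (xiMap n d z - S.σ⁻¹ • S.vt + xiMap n d h) -
        prox S.p (xiMap n d z - S.σ⁻¹ • S.vt) - Matrix.toEuclideanLin Q (xiMap n d h),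
        xiMap n d w⟫_ℝ) := by
    rw [inner_sub_left, inner_sub_left, inner_gradPhi, inner_gradPhi, S.inner_genHessian hH, ← e2]
    simp only [map_add, add_sub_right_comm, inner_add_left, inner_sub_left]
    ring
  dsimp only
  rw [key, ← mul_neg, ← inner_neg_left]
  calc _ ≤ S.σ * (‖prox S.p (xiMap n d z - S.σ⁻¹ • S.vt + xiMap n d h) -
        prox S.p (xiMap n d z - S.σ⁻¹ • S.vt) - Matrix.toEuclideanLin Q (xiMap n d h)‖ *
        ‖xiMap n d w‖) := by
        refine mul_le_mul_of_nonneg_left ?_ hσ.le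
        rw [← norm_neg (prox S.p _ - _ - _)]
        exact real_inner_le_norm _ _
    _ ≤ S.σ * ((|C| * ‖h‖ ^ 2) * ‖w‖) := by
        have := norm_xiMap_le w
        have e3 := e1.trans (mul_le_mul (le_abs_self C)
          (pow_le_pow_left₀ (norm_nonneg _) hξ 2) (by positivity) (abs_nonneg _))
        gcongr
    _ = _ := by ring

/-- The trapezoidal rule is exact for the quadratic terms and, near the base point, for the orthant
term. The cubic error comes from the distance to `blockSet n S.D` alone. -/
theorem exists_trapezoid (hne : S.D.Nonempty) (hcl : IsClosed S.D) (hcv : Convex ℝ S.D)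
    (hσ : 0 < S.σ) (hH₁ : S.H₁.IsHermitian) (hH₂ : S.H₂.IsHermitian)
    (hprox : StronglySemismooth (prox S.p) (clarkeJacobian (prox S.p))) (z : Var n d) :
    ∃ C, ∃ ε > 0, ∀ h, ‖h‖ < ε →
      1 / 2 * ⟪S.gradPhi (z + h) - S.gradPhi z, h⟫_ℝ - C * ‖h‖ ^ 3 ≤
        S.Phi (z + h) - S.Phi z - ⟪S.gradPhi z, h⟫_ℝ := by
  obtain ⟨g, hg, hG⟩ := exists_forall_norm_le S.constraintMap
  obtain ⟨C, ε₁, hε₁, hC⟩ := (isProjection_prox_p hne hcl hcv).exists_trapezoid_le hprox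
    (xiMap n d z - S.σ⁻¹ • S.vt)
  obtain ⟨ε₂, hε₂, hP⟩ := exists_prox_orthant_trapezoid (S.constraintMap z - S.σ⁻¹ • S.ut)
  refine ⟨S.σ * |C|, min ε₁ (ε₂ / (g + 1)), lt_min hε₁ (by positivity), fun h hh => ?_⟩
  have hξ := norm_xiMap_le h
  have hh₁ : ‖xiMap n d h‖ < ε₁ := hξ.trans_lt (hh.trans_le (min_le_left _ _))
  have hh₂ : ‖S.constraintMap h‖ < ε₂ := by
    have h1 := hh.trans_le (min_le_right _ _)
    rw [lt_div_iff₀ (by positivity)] at h1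
    nlinarith [hG h, norm_nonneg h]
  have e1 := mul_le_mul_of_nonneg_left (hC _ hh₁) hσ.le
  have e2 := hP _ hh₂
  have e3 : C * ‖xiMap n d h‖ ^ 3 ≤ |C| * ‖h‖ ^ 3 :=
    mul_le_mul (le_abs_self C) (pow_le_pow_left₀ (norm_nonneg _) hξ 3) (by positivity)
      (abs_nonneg _)
  have e4 := mul_le_mul_of_nonneg_left e3 hσ.le
  rw [Phi_bregman hne hcl hcv hσ hH₁ hH₂ z h rfl rfl, ← e2, inner_sub_left, inner_gradPhi,
    inner_gradPhi]
  unfold normSqH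
  rw [← real_inner_self_eq_norm_sq (thetaMap n d h),
    real_inner_comm (Matrix.toEuclideanLin S.H₁ (thetaMap n d h)),
    real_inner_comm (Matrix.toEuclideanLin S.H₂ (xiMap n d h))]
  simp only [map_add, add_sub_right_comm, inner_add_left, inner_sub_left] at e1 e2 ⊢
  linarith

end Subproblem

end Assembly

end ConvexRegression

theorem theorem3 {n d : ℕ} (S : Subproblem n d)
    (hD_nonempty : S.D.Nonempty) (hD_closed : IsClosed S.D) (hD_convex : Convex ℝ S.D)
    (hσ : 0 < S.σ) (hH₁ : S.H₁.PosDef) (hH₂ : S.H₂.PosDef)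
    (hprox : StronglySemismooth (prox S.p) (clarkeJacobian (prox S.p)))
    (γ τ δ μ : ℝ) (hγ : γ ∈ Set.Ioo (0 : ℝ) 1) (hτ : τ ∈ Set.Ioc (0 : ℝ) 1)
    (hδ : δ ∈ Set.Ioo (0 : ℝ) 1) (hμ : μ ∈ Set.Ioo (0 : ℝ) (1 / 2))
    (z : ℕ → Var n d) (hz : ∀ j, S.SSNStep γ τ δ μ (z j) (z (j + 1))) :
    ∃ zbar : Var n d,
      (∀ w, S.Phi zbar ≤ S.Phi w) ∧
      (∀ y, (∀ w, S.Phi y ≤ S.Phi w) → y = zbar) ∧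
      Tendsto z atTop (𝓝 zbar) ∧
      (fun j => ‖z (j + 1) - zbar‖) =O[atTop] (fun j => ‖z j - zbar‖ ^ (1 + τ)) ∧
      (fun j => ‖z (j + 1) - zbar‖) =o[atTop] (fun j => ‖z j - zbar‖) ∧
      (τ = 1 → (fun j => ‖z (j + 1) - zbar‖) =O[atTop] (fun j => ‖z j - zbar‖ ^ 2)) := by
  obtain ⟨c, hc, L, hL, hΦ, hK⟩ :=
    Subproblem.exists_bounds hD_nonempty hD_closed hD_convex hσ hH₁ hH₂
  refine newton_convergence hc hL hΦ hγ hτ hδ hμ hK (Subproblem.exists_semismooth hprox hσ)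
    (Subproblem.exists_trapezoid hD_nonempty hD_closed hD_convex hσ hH₁.isHermitian
      hH₂.isHermitian hprox) fun j => ?_
  obtain ⟨H, hH, Δ, hdir, hres, m, hm, hnext⟩ := hz j
  have hgrad : gradient S.Phi (z j) = S.gradPhi (z j) :=
    (hΦ.hasGradientAt hc.le (z j)).gradient
  rw [hgrad] at hdir hres hm
  refine ⟨Matrix.toEuclideanLin H, ⟨H, hH, rfl⟩, Δ, m, ⟨?_, hres, hm⟩, hnext⟩
  have hpos : ∀ v, v ≠ 0 → 0 < inner ℝ v (Matrix.toEuclideanLin H v) := by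
    intro v hv
    have h1 := (hK (z j) _ ⟨H, hH, rfl⟩ v).1
    have h2 : 0 < ‖v‖ := norm_pos_iff.mpr hv
    rw [real_inner_comm]
    exact lt_of_lt_of_le (by positivity) h1
  -- The right-hand side is `-∇Φ`, so the system residual `H Δ - b` is the vector `H Δ + ∇Φ` of the
  -- orthogonality condition.
  have h3 := hdir.inner_residual (Subproblem.isHermitian_of_mem_genHessian hD_nonempty hD_closed
    hD_convex hH₁.isHermitian hH₂.isHermitian hH) hpos
  rwa [sub_neg_eq_add] at h3
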